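/- **Setting.** A platform interacts with $N$ users. User $n$ has an unknown threshold $\theta_n\in(0,1)$; the $\theta_n$ are i.i.d. with distribution function $F$. In the $t$-th round with user $n$ the platform performs an action $y_n(t)\in[0,1]$ and earns $\gamma^{t-1}r(y_n(t))\mathbf 1(y_n(t)\le\theta_n)$, where $\gamma\in[0,1)$. Each action above the threshold costs one unit of the user's patience, which is $B>0$ initially; the user abandons the platform (which the platform sees) as soon as no patience is left; $T_n\le\infty$ is the number of rounds with user $n$. Hard feedback: the signal $\mathbf 1(y_n(t)\le\theta_n)$ is always revealed (put $p_1=p_2=1$). Soft feedback, with parameters $p_1,p_2\in(0,1)$: it is revealed with probability $p_1$ if $y_n(t)\le\theta_n$ and with probability $p_2$ if $y_n(t)>\theta_n$, independently of everything else. A learning algorithm is a (possibly randomized) rule that, from everything observed so far, chooses the next user to address (users may be interleaved) and the action; it knows $r,B,N,\gamma$ and all other parameters, but not $F$. **$\delta$-regret.** Consider the Markov decision process with states $(\ell,u,b)$, $0\le\ell\le u\le1$, in which action $y\in[\ell,u]$ has value $$V(\ell,u,b,y)=\tfrac{F(u)-F(y)}{F(u)-F(\ell)}\bigl(r(y)+\gamma(1-p_1)V^*(\ell,u,b)+\gamma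 p_1V^*(y,u,b)\bigr)+\tfrac{F(y)-F(\ell)}{F(u)-F(\ell)}\gamma\bigl(p_2V^*(\ell,y,b-1)+(1-p_2)V^*(\ell,u,b-1)\bigr),$$ with $V^*(\ell,u,b)=\max_{\ell\le y\le u}V(\ell,u,b,y)$ for $b>0$ and $V^*(\ell,u,b)=0$ for $b\le0$; let $y^*(\ell,u,b)$ be a maximizer (chosen in any way). The $\delta$-policy plays $y^*(\ell,u,b)$ if $u-\ell>\delta$ and $\ell$ if $u-\ell\le\delta$; $V^*_\delta(\ell,u,b)$ is its expected total discounted reward in this process started from $(\ell,u,b)$. The $\delta$-regret of an algorithm is $$R_\delta(N)=N\,V^*_\delta(0,1,B)-\mathbf E\Bigl[\sum_{n=1}^N\sum_{t=1}^{T_n}\gamma^{t-1}r(y_n(t))\mathbf 1(y_n(t)\le\theta_n)\Bigr].$$ **Class.** For $L_r>0$ and $L_h>1$ let $\mathcal F(L_h,L_r)$ be the set of pairs $(F,r)$ where $F$ is the distribution function of a probability law on $(0,1)$ such that, for some $L_c>0$, $L_c(y-x)\le F(y)-F(x)\le L_h(y-x)$ whenever $0\le x\le y\le1$, and $r$ is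 positive, non-decreasing and $L_r$-Lipschitz on $[0,1]$ (no upper bound on $r$ is imposed). Put $L=L_r+L_h$. **Theorem.** For every $\eta>0$ there is a constant $\tilde M>0$, depending only on $\eta$, such that the following holds. Let $L_r\ge\eta$, $L_h\ge1+\eta$, $B>0$, $0\le\delta<1$, $0\le\gamma<1$, and let the feedback be hard, or soft with any $p_1,p_2\in(0,1)$. Then for all integers $N\ge\max\{L,\,0.08\,L^{2/3}\}$ and every learning algorithm, $$\sup_{(F,r)\in\mathcal F(L_h,L_r)}R_\delta(N)\ \ge\ \tilde M\,L^{1/3}N^{2/3}.$$ -/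

import Mathlib

open MeasureTheory ProbabilityTheory

namespace SequentialChoice

noncomputable section

/-! ### Thresholds, rewards, feedback -/

/-- The feedback model. After an action below (resp. above) the threshold the signal is revealed
with probability `p₁` (resp. `p₂`). Hard feedback: always revealed. Soft feedback: both
probabilities lie strictly between `0` and `1`. -/
structure FeedbackModel where
  p₁ : ℝ
  p₂ : ℝ
  valid : (p₁ = 1 ∧ p₂ = 1) ∨ (p₁ ∈ Set.Ioo (0 : ℝ) 1 ∧ p₂ ∈ Set.Ioo (0 : ℝ) 1)

/-- `μ` is an admissible law of the thresholds: a probability measure on `(0,1)` whose distribution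
function `F` satisfies `L_c (y - x) ≤ F y - F x ≤ L_h (y - x)` for `0 ≤ x ≤ y ≤ 1`, where
`L_h` is given and `L_c > 0` is some constant. -/
def IsThresholdLaw (L_h : ℝ) (μ : Measure ℝ) : Prop :=
  IsProbabilityMeasure μ ∧ μ (Set.Ioo (0 : ℝ) 1) = 1 ∧
    ∃ L_c : ℝ, 0 < L_c ∧ ∀ x ∈ Set.Icc (0 : ℝ) 1, ∀ y ∈ Set.Icc (0 : ℝ) 1, x ≤ y →
      L_c * (y - x) ≤ cdf μ y - cdf μ x ∧ cdf μ y - cdf μ x ≤ L_h * (y - x)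

/-- `r` is an admissible reward function: positive, non-decreasing and `L_r`-Lipschitz
on `[0,1]`. -/
def IsRewardFunction (L_r : ℝ) (r : ℝ → ℝ) : Prop :=
  (∀ y ∈ Set.Icc (0 : ℝ) 1, 0 < r y) ∧ MonotoneOn r (Set.Icc 0 1) ∧
    ∀ x ∈ Set.Icc (0 : ℝ) 1, ∀ y ∈ Set.Icc (0 : ℝ) 1, x ≤ y → r y - r x ≤ L_r * (y - x)

/-- The class of pairs (threshold law, reward function) over which the worst case is taken. -/
def environments (L_h L_r : ℝ) : Set (Measure ℝ × (ℝ → ℝ)) :=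
  {e | IsThresholdLaw L_h e.1 ∧ IsRewardFunction L_r e.2}

/-! ### The Markov decision process of a single user

States `(ℓ, u, b)`: uncertainty interval `[ℓ, u]` and residual patience `b`. A user is present as
long as `b > 0`; every action above the threshold costs one unit of patience. -/

/-- Expected reward of action `y` in state `(ℓ, u, b)` when the value of later states is `V`. -/
def actionValue (F r : ℝ → ℝ) (γ : ℝ) (fb : FeedbackModel) (V : ℝ → ℝ → ℝ → ℝ)
    (ℓ u b y : ℝ) : ℝ :=
  (F u - F y) / (F u - F ℓ) *
      (r y + γ * (1 - fb.p₁) * V ℓ u b + γ * fb.p₁ * V y u b) +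
    (F y - F ℓ) / (F u - F ℓ) * γ *
      (fb.p₂ * V ℓ y (b - 1) + (1 - fb.p₂) * V ℓ u (b - 1))

/-- Optimal expected reward over the next `k` rounds. -/
def optimalIter (F r : ℝ → ℝ) (γ : ℝ) (fb : FeedbackModel) : ℕ → ℝ → ℝ → ℝ → ℝ
  | 0 => fun _ _ _ => 0
  | k + 1 => fun ℓ u b =>
      if 0 < b then
        ⨆ y : Set.Icc ℓ u, actionValue F r γ fb (optimalIter F r γ fb k) ℓ u b y
      else 0

/-- The optimal value function `V*`: the increasing limit of the finite-horizon optimal values,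
that is, the bounded solution of the Bellman equation
`V* ℓ u b = max_{ℓ ≤ y ≤ u} actionValue V* ℓ u b y` with `V* ℓ u b = 0` for `b ≤ 0`. -/
def optimalValue (F r : ℝ → ℝ) (γ : ℝ) (fb : FeedbackModel) (ℓ u b : ℝ) : ℝ :=
  ⨆ k : ℕ, optimalIter F r γ fb k ℓ u b

/-- `ystar` is a choice `y*(ℓ, u, b) ∈ argmax_{ℓ ≤ y ≤ u} V(ℓ, u, b, y)` of Bellman-optimal
actions. (For continuous, strictly increasing `F` and continuous `r`, maximizers exist in all
states with `ℓ < u`; they need not be unique.) -/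
def IsOptimalAction (F r : ℝ → ℝ) (γ : ℝ) (fb : FeedbackModel)
    (ystar : ℝ → ℝ → ℝ → ℝ) : Prop :=
  ∀ ℓ u b : ℝ, 0 ≤ ℓ → ℓ < u → u ≤ 1 → 0 < b →
    ystar ℓ u b ∈ Set.Icc ℓ u ∧
      IsMaxOn (actionValue F r γ fb (optimalValue F r γ fb) ℓ u b) (Set.Icc ℓ u) (ystar ℓ u b)

/-- The `δ`-policy: the optimal action if `|u - ℓ| > δ`, the safe action `ℓ` otherwise. -/
def deltaAction (δ : ℝ) (ystar : ℝ → ℝ → ℝ → ℝ) (ℓ u b : ℝ) : ℝ :=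
  if δ < |u - ℓ| then ystar ℓ u b else ℓ

/-- Expected reward of the stationary policy `y` over the next `k` rounds. -/
def policyIter (F r : ℝ → ℝ) (γ : ℝ) (fb : FeedbackModel) (y : ℝ → ℝ → ℝ → ℝ) :
    ℕ → ℝ → ℝ → ℝ → ℝ
  | 0 => fun _ _ _ => 0
  | k + 1 => fun ℓ u b =>
      if 0 < b then actionValue F r γ fb (policyIter F r γ fb y k) ℓ u b (y ℓ u b) else 0

/-- Expected total discounted reward of the stationary policy `y` started in `(ℓ, u, b)`
(the increasing limit of the finite-horizon rewards). -/
def policyValue (F r : ℝ → ℝ) (γ : ℝ) (fb : FeedbackModel) (y : ℝ → ℝ → ℝ → ℝ)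
    (ℓ u b : ℝ) : ℝ :=
  ⨆ k : ℕ, policyIter F r γ fb y k ℓ u b

/-! ### Learning algorithms and their interaction with `N` users -/

/-- What the platform sees after an action: the signal `1(y ≤ θ)` if it is revealed, and whether
the addressed user is gone. -/
structure Observation where
  feedback : Option Bool
  abandoned : Bool

/-- A (possibly randomized) learning algorithm for `N` users. At each step it selects, from its
random seed and all observations so far (latest first), the user to be addressed and the
action to be performed; its own earlier choices are functions of the same data, hence
available to it. Users may be addressed in any order, also interleaved; addressing a user who has
abandoned has no effect. -/
structure LearningAlgorithm (N : ℕ) where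
  Seed : Type
  [seedSpace : MeasurableSpace Seed]
  law : Measure Seed
  isProbabilityMeasure_law : IsProbabilityMeasure law
  choose : Seed → List Observation → Fin N × ℝ
  measurable_choose : ∀ h : List Observation, Measurable fun ω => choose ω h
  action_mem : ∀ ω h, (choose ω h).2 ∈ Set.Icc (0 : ℝ) 1

attribute [instance] LearningAlgorithm.seedSpace

/-- State of the interaction: observations so far, number of rounds played with each user, number
of times the threshold of each user was crossed. -/
structure PlatformState (N : ℕ) where
  history : List Observation
  rounds : Fin N → ℕ
  crossings : Fin N → ℕ

/-- User `n` with initial patience `B` has not abandoned: some patience is left. -/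
def PlatformState.Active {N : ℕ} (B : ℝ) (s : PlatformState N) (n : Fin N) : Prop :=
  0 < B - s.crossings n

open Classical in
/-- One step: action `a.2` for user `a.1`, with thresholds `θ`; the signal is revealed if the
uniform variable `c` is at most `p₁` (action below threshold) or `p₂` (above). -/
def PlatformState.step {N : ℕ} (fb : FeedbackModel) (B : ℝ) (θ : Fin N → ℝ) (c : ℝ)
    (a : Fin N × ℝ) (s : PlatformState N) : PlatformState N :=
  if s.Active B a.1 then
    if a.2 ≤ θ a.1 then
      { history := ⟨if c ≤ fb.p₁ then some true else none, false⟩ :: s.history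
        rounds := Function.update s.rounds a.1 (s.rounds a.1 + 1)
        crossings := s.crossings }
    else
      { history := ⟨if c ≤ fb.p₂ then some false else none,
            decide (B - (s.crossings a.1 + 1) ≤ 0)⟩ :: s.history
        rounds := Function.update s.rounds a.1 (s.rounds a.1 + 1)
        crossings := Function.update s.crossings a.1 (s.crossings a.1 + 1) }
  else
    { history := ⟨none, true⟩ :: s.history
      rounds := s.rounds
      crossings := s.crossings }

/-- The state after `k` steps. -/
def run {N : ℕ} (fb : FeedbackModel) (B : ℝ) (A : LearningAlgorithm N) (θ : Fin N → ℝ)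
    (coin : ℕ → unitInterval) (ω : A.Seed) : ℕ → PlatformState N
  | 0 => ⟨[], fun _ => 0, fun _ => 0⟩
  | k + 1 =>
      (run fb B A θ coin ω k).step fb B θ (coin k) (A.choose ω (run fb B A θ coin ω k).history)

open Classical in
/-- Discounted reward `γ^(t-1) r(y) 1(y ≤ θ)` received in step `k`, where `t` is the number of
the round with the addressed user. -/
def stepReward {N : ℕ} (r : ℝ → ℝ) (γ : ℝ) (fb : FeedbackModel) (B : ℝ)
    (A : LearningAlgorithm N) (θ : Fin N → ℝ) (coin : ℕ → unitInterval) (ω : A.Seed)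
    (k : ℕ) : ℝ :=
  let s := run fb B A θ coin ω k
  let a := A.choose ω s.history
  if s.Active B a.1 ∧ a.2 ≤ θ a.1 then γ ^ s.rounds a.1 * r a.2 else 0

/-- Expected total discounted reward of `A` from `N` users whose thresholds are independent with
law `μ`. -/
def expectedReward {N : ℕ} (μ : Measure ℝ) (r : ℝ → ℝ) (γ : ℝ) (fb : FeedbackModel) (B : ℝ)
    (A : LearningAlgorithm N) : ℝ :=
  ∫ x : (Fin N → ℝ) × (ℕ → unitInterval) × A.Seed,
      ∑' k : ℕ, stepReward r γ fb B A x.1 x.2.1 x.2.2 k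
    ∂((Measure.pi fun _ => μ).prod
      ((Measure.infinitePi fun _ => (volume : Measure unitInterval)).prod A.law))

/-- The `δ`-regret `N V*_δ(0, 1, B) - E[total reward of A]`, where the `δ`-policy is built on the
Bellman-optimal actions `ystar`. -/
def deltaRegret {N : ℕ} (μ : Measure ℝ) (r : ℝ → ℝ) (γ : ℝ) (fb : FeedbackModel) (B δ : ℝ)
    (ystar : ℝ → ℝ → ℝ → ℝ) (A : LearningAlgorithm N) : ℝ :=
  N * policyValue (cdf μ) r γ fb (deltaAction δ ystar) 0 1 B - expectedReward μ r γ fb B A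

end

end SequentialChoice

namespace SequentialChoice

noncomputable section

/-! ### Bounds for the decision process of a single user -/

/-! The regret is forced to be linear in N by two environments that share one reward function, so
that the learner, who knows `r` but not the law, uses the same algorithm in both. Put a = η/(1+η), c
= ηa/(1-γ) and r(y) = R + η min(y, a). Playing above 0 brings at most c per user beyond R/(1-γ),
whereas a crossing forfeits a round worth at least R. The thresholds are uniform on [a, 1) with
weight 1-ε and uniform on (0, a) with weight ε. For tiny ε (flat case) the δ-policy earns almost
R/(1-γ) + c per user. For ε = 8c/R (steep case) the risk of every positive action outweighs its
gain, and the δ-policy plays 0 and earns R/(1-γ). These benchmarks, valid for every choice of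
maximizers, are `policyValue_ge_of_flat` and `policyValue_ge_of_steep`.

As r has no upper bound, R may be of order Nc. Then Nε ≤ 1/2, and with probability at least 1/2 all
thresholds are at least a; restricted to that event the two environments are proportional
(`smul_pi_highLaw_le`). Hence both regrets are controlled by one number z, the expected discounted
sum of min(y, a) over all users when all thresholds come from `highLaw a`. Up to small errors the
regret is at least (Nc - ηz)/2 in the flat case and 3ηz/2 in the steep case, so one of them is of
order Nc. Finally N ≥ L gives N ≥ L^(1/3) N^(2/3).

The steep estimate compares runs. If one user's threshold is lowered from above a to a uniform x in
(0, a), nothing changes until an action exceeds x (`run_update_eq`), and that crossing costs at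
least R/2 times the discount of its round (`sum_userReward_update_le`). Summation by parts shows
that this discount has mean at least (1-γ)/a times the exploration of the original run
(`integral_crossingDiscount_ge`). -/

theorem FeedbackModel.p₁_mem (fb : FeedbackModel) : 0 ≤ fb.p₁ ∧ fb.p₁ ≤ 1 := by
  rcases fb.valid with h | h
  · rw [h.1]; norm_num
  · exact ⟨h.1.1.le, h.1.2.le⟩

theorem FeedbackModel.p₂_mem (fb : FeedbackModel) : 0 ≤ fb.p₂ ∧ fb.p₂ ≤ 1 := by
  rcases fb.valid with h | h
  · rw [h.2]; norm_num
  · exact ⟨h.2.1.le, h.2.2.le⟩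

section DecisionProcess

variable {F r : ℝ → ℝ} {γ : ℝ} {fb : FeedbackModel}

theorem success_weight_nonneg (hF : MonotoneOn F (Set.Icc 0 1)) {ℓ y u : ℝ} (h0 : 0 ≤ ℓ)
    (hℓ : ℓ ≤ y) (hu : y ≤ u) (h1 : u ≤ 1) : 0 ≤ (F u - F y) / (F u - F ℓ) :=
  div_nonneg (sub_nonneg.2 (hF ⟨by linarith, by linarith⟩ ⟨by linarith, h1⟩ hu))
    (sub_nonneg.2 (hF ⟨h0, by linarith⟩ ⟨by linarith, h1⟩ (hℓ.trans hu)))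

theorem failure_weight_nonneg (hF : MonotoneOn F (Set.Icc 0 1)) {ℓ y u : ℝ} (h0 : 0 ≤ ℓ)
    (hℓ : ℓ ≤ y) (hu : y ≤ u) (h1 : u ≤ 1) : 0 ≤ (F y - F ℓ) / (F u - F ℓ) :=
  div_nonneg (sub_nonneg.2 (hF ⟨h0, by linarith⟩ ⟨by linarith, by linarith⟩ hℓ))
    (sub_nonneg.2 (hF ⟨h0, by linarith⟩ ⟨by linarith, h1⟩ (hℓ.trans hu)))

theorem weights_add_le_one (F : ℝ → ℝ) (ℓ y u : ℝ) :
    (F u - F y) / (F u - F ℓ) + (F y - F ℓ) / (F u - F ℓ) ≤ 1 := by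
  rw [← add_div, sub_add_sub_cancel]
  exact div_self_le_one _

theorem weights_add_eq_one {ℓ u : ℝ} (h : F ℓ < F u) (y : ℝ) :
    (F u - F y) / (F u - F ℓ) = 1 - (F y - F ℓ) / (F u - F ℓ) := by
  have : F u - F ℓ ≠ 0 := by linarith
  field_simp
  ring

theorem actionValue_nonneg (hF : MonotoneOn F (Set.Icc 0 1)) (hγ : 0 ≤ γ)
    (hr : ∀ y ∈ Set.Icc (0 : ℝ) 1, 0 ≤ r y) {V : ℝ → ℝ → ℝ → ℝ}
    (hV : ∀ ℓ u b, 0 ≤ ℓ → ℓ ≤ u → u ≤ 1 → 0 ≤ V ℓ u b)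
    {ℓ u b y : ℝ} (h0 : 0 ≤ ℓ) (hℓ : ℓ ≤ y) (hu : y ≤ u) (h1 : u ≤ 1) :
    0 ≤ actionValue F r γ fb V ℓ u b y := by
  have hs := success_weight_nonneg hF h0 hℓ hu h1
  have hf := failure_weight_nonneg hF h0 hℓ hu h1
  have hry := hr y ⟨h0.trans hℓ, hu.trans h1⟩
  have v1 := hV ℓ u b h0 (hℓ.trans hu) h1
  have v2 := hV y u b (h0.trans hℓ) hu h1
  have v3 := hV ℓ y (b - 1) h0 hℓ (hu.trans h1)
  have v4 := hV ℓ u (b - 1) h0 (hℓ.trans hu) h1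
  have p1 := fb.p₁_mem
  have p2 := fb.p₂_mem
  have e1 : 0 ≤ 1 - fb.p₁ := by linarith
  have e2 : 0 ≤ 1 - fb.p₂ := by linarith
  have p10 := p1.1
  have p20 := p2.1
  unfold actionValue
  positivity

/-- Monotonicity of the Bellman operator, for an upper bound that depends on the left end only. -/
theorem actionValue_le (hF : MonotoneOn F (Set.Icc 0 1)) (hγ : 0 ≤ γ) {V : ℝ → ℝ → ℝ → ℝ}
    {G : ℝ → ℝ} (hV : ∀ ℓ u b, 0 ≤ ℓ → ℓ ≤ u → u ≤ 1 → V ℓ u b ≤ G ℓ)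
    {ℓ u b y : ℝ} (h0 : 0 ≤ ℓ) (hℓ : ℓ ≤ y) (hu : y ≤ u) (h1 : u ≤ 1) :
    actionValue F r γ fb V ℓ u b y ≤
      (F u - F y) / (F u - F ℓ) * (r y + γ * (1 - fb.p₁) * V ℓ u b + γ * fb.p₁ * G y) +
        (F y - F ℓ) / (F u - F ℓ) * γ * G ℓ := by
  have hs := success_weight_nonneg hF h0 hℓ hu h1
  have hf := failure_weight_nonneg hF h0 hℓ hu h1
  have v2 := hV y u b (h0.trans hℓ) hu h1
  have v3 := hV ℓ y (b - 1) h0 hℓ (hu.trans h1)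
  have v4 := hV ℓ u (b - 1) h0 (hℓ.trans hu) h1
  have p1 := fb.p₁_mem
  have p2 := fb.p₂_mem
  unfold actionValue
  have : fb.p₂ * V ℓ y (b - 1) + (1 - fb.p₂) * V ℓ u (b - 1) ≤ G ℓ := by
    nlinarith
  have h5 : γ * fb.p₁ * V y u b ≤ γ * fb.p₁ * G y :=
    mul_le_mul_of_nonneg_left v2 (mul_nonneg hγ p1.1)
  gcongr

/-! ### Bounds for the optimal values -/

theorem optimalIter_nonneg (hF : MonotoneOn F (Set.Icc 0 1)) (hγ : 0 ≤ γ)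
    (hr : ∀ y ∈ Set.Icc (0 : ℝ) 1, 0 ≤ r y) (k : ℕ) :
    ∀ ℓ u b, 0 ≤ ℓ → ℓ ≤ u → u ≤ 1 → 0 ≤ optimalIter F r γ fb k ℓ u b := by
  induction k with
  | zero => intros; exact le_rfl
  | succ k ih =>
    intro ℓ u b h0 hu h1
    simp only [optimalIter]
    split_ifs
    · exact Real.iSup_nonneg fun y => actionValue_nonneg hF hγ hr ih h0 y.2.1 y.2.2 h1
    · exact le_rfl

/-- Value iteration stays below any supersolution `G` of the Bellman equation. Bounds in the left
end alone suffice because a failure keeps the left end, whether or not the signal is revealed. -/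
theorem optimalIter_le (hF : MonotoneOn F (Set.Icc 0 1)) (hγ : 0 ≤ γ)
    {G : ℝ → ℝ} (hG0 : ∀ ℓ ∈ Set.Icc (0 : ℝ) 1, 0 ≤ G ℓ)
    (hG : ∀ ℓ u y, 0 ≤ ℓ → ℓ ≤ y → y ≤ u → u ≤ 1 →
      (F u - F y) / (F u - F ℓ) * (r y + γ * (1 - fb.p₁) * G ℓ + γ * fb.p₁ * G y) +
        (F y - F ℓ) / (F u - F ℓ) * γ * G ℓ ≤ G ℓ) (k : ℕ) :
    ∀ ℓ u b, 0 ≤ ℓ → ℓ ≤ u → u ≤ 1 → optimalIter F r γ fb k ℓ u b ≤ G ℓ := by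
  induction k with
  | zero => intro ℓ u b h0 hu h1; exact hG0 ℓ ⟨h0, hu.trans h1⟩
  | succ k ih =>
    intro ℓ u b h0 hu h1
    simp only [optimalIter]
    split_ifs
    · have : Nonempty (Set.Icc ℓ u) := ⟨⟨ℓ, le_rfl, hu⟩⟩
      refine ciSup_le fun y => (actionValue_le hF hγ ih h0 y.2.1 y.2.2 h1).trans
        (le_trans ?_ (hG ℓ u y h0 y.2.1 y.2.2 h1))
      have hs := success_weight_nonneg hF h0 y.2.1 y.2.2 h1
      have h2 : γ * (1 - fb.p₁) * optimalIter F r γ fb k ℓ u b ≤ γ * (1 - fb.p₁) * G ℓ :=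
        mul_le_mul_of_nonneg_left (ih ℓ u b h0 hu h1)
          (mul_nonneg hγ (sub_nonneg.2 fb.p₁_mem.2))
      gcongr
    · exact hG0 ℓ ⟨h0, hu.trans h1⟩

/-- The trivial supersolution of the Bellman equation. -/
theorem const_supersolution (hF : MonotoneOn F (Set.Icc 0 1)) (hγ1 : γ < 1)
    {ρ : ℝ} (hρ : 0 ≤ ρ) (hr : ∀ y ∈ Set.Icc (0 : ℝ) 1, r y ≤ ρ) {ℓ u y : ℝ} (h0 : 0 ≤ ℓ)
    (hℓ : ℓ ≤ y) (hu : y ≤ u) (h1 : u ≤ 1) :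
    (F u - F y) / (F u - F ℓ) *
        (r y + γ * (1 - fb.p₁) * (ρ / (1 - γ)) + γ * fb.p₁ * (ρ / (1 - γ))) +
      (F y - F ℓ) / (F u - F ℓ) * γ * (ρ / (1 - γ)) ≤ ρ / (1 - γ) := by
  have hs := success_weight_nonneg hF h0 hℓ hu h1
  have hf := failure_weight_nonneg hF h0 hℓ hu h1
  have hw := weights_add_le_one F ℓ y u
  have hry := hr y ⟨h0.trans hℓ, hu.trans h1⟩
  set p := (F u - F y) / (F u - F ℓ)
  set q := (F y - F ℓ) / (F u - F ℓ)
  have h1γ : 0 < 1 - γ := by linarith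
  set C := ρ / (1 - γ) with hC
  have hC0 : 0 ≤ C := by positivity
  have hCe : C = ρ + γ * C := by rw [hC]; field_simp; ring
  have e1 : r y + γ * (1 - fb.p₁) * C + γ * fb.p₁ * C ≤ C := by linarith
  have e2 : γ * C ≤ C := by nlinarith
  calc p * (r y + γ * (1 - fb.p₁) * C + γ * fb.p₁ * C) + q * γ * C
      ≤ p * C + q * C := by rw [mul_assoc q]; gcongr
    _ ≤ C := by nlinarith

theorem optimalIter_le_const (hF : MonotoneOn F (Set.Icc 0 1)) (hγ : 0 ≤ γ) (hγ1 : γ < 1)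
    {ρ : ℝ} (hρ : 0 ≤ ρ) (hr : ∀ y ∈ Set.Icc (0 : ℝ) 1, r y ≤ ρ) (k : ℕ) {ℓ u : ℝ} (b : ℝ)
    (h0 : 0 ≤ ℓ) (hu : ℓ ≤ u) (h1 : u ≤ 1) : optimalIter F r γ fb k ℓ u b ≤ ρ / (1 - γ) :=
  optimalIter_le (G := fun _ => ρ / (1 - γ)) hF hγ
    (fun _ _ => div_nonneg hρ (by linarith))
    (fun _ _ _ a1 a2 a3 a4 => const_supersolution hF hγ1 hρ hr a1 a2 a3 a4) k ℓ u b h0 hu h1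

theorem optimalValue_nonneg (hF : MonotoneOn F (Set.Icc 0 1)) (hγ : 0 ≤ γ)
    (hr : ∀ y ∈ Set.Icc (0 : ℝ) 1, 0 ≤ r y) (ℓ u b : ℝ) (h0 : 0 ≤ ℓ) (hu : ℓ ≤ u)
    (h1 : u ≤ 1) : 0 ≤ optimalValue F r γ fb ℓ u b :=
  Real.iSup_nonneg fun k => optimalIter_nonneg hF hγ hr k ℓ u b h0 hu h1

/-- Repeating the safe action `ℓ` never fails and never changes the state, so it collects `r ℓ` in
every round. -/
theorem optimalIter_ge (hF : MonotoneOn F (Set.Icc 0 1)) (hγ : 0 ≤ γ) (hγ1 : γ < 1)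
    (hr : ∀ y ∈ Set.Icc (0 : ℝ) 1, 0 ≤ r y) {ρ : ℝ} (hρ : ∀ y ∈ Set.Icc (0 : ℝ) 1, r y ≤ ρ)
    {ℓ u b : ℝ} (h0 : 0 ≤ ℓ) (hu : ℓ ≤ u) (h1 : u ≤ 1) (hlt : F ℓ < F u) (hb : 0 < b) (k : ℕ) :
    r ℓ * ∑ j ∈ Finset.range k, γ ^ j ≤ optimalIter F r γ fb k ℓ u b := by
  have hρ0 : 0 ≤ ρ := (hr 0 (by simp)).trans (hρ 0 (by simp))
  induction k with
  | zero => simp [optimalIter]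
  | succ k ih =>
    simp only [optimalIter, if_pos hb]
    have hbdd : BddAbove (Set.range fun y : Set.Icc ℓ u =>
        actionValue F r γ fb (optimalIter F r γ fb k) ℓ u b y) := by
      refine ⟨ρ / (1 - γ), ?_⟩
      rintro _ ⟨y, rfl⟩
      refine (actionValue_le (G := fun _ => ρ / (1 - γ)) hF hγ
        (fun ℓ u b a1 a2 a3 => optimalIter_le_const hF hγ hγ1 hρ0 hρ k b a1 a2 a3)
        h0 y.2.1 y.2.2 h1).trans
        (le_trans ?_ (const_supersolution (fb := fb) hF hγ1 hρ0 hρ h0 y.2.1 y.2.2 h1))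
      have hs := success_weight_nonneg hF h0 y.2.1 y.2.2 h1
      have h2 : γ * (1 - fb.p₁) * optimalIter F r γ fb k ℓ u b ≤
          γ * (1 - fb.p₁) * (ρ / (1 - γ)) :=
        mul_le_mul_of_nonneg_left (optimalIter_le_const hF hγ hγ1 hρ0 hρ k b h0 hu h1)
          (mul_nonneg hγ (sub_nonneg.2 fb.p₁_mem.2))
      gcongr
    refine le_trans ?_ (le_ciSup hbdd ⟨ℓ, le_rfl, hu⟩)
    have hne : F u - F ℓ ≠ 0 := by linarith
    have : actionValue F r γ fb (optimalIter F r γ fb k) ℓ u b ℓ =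
        r ℓ + γ * optimalIter F r γ fb k ℓ u b := by
      unfold actionValue
      rw [div_self hne, sub_self, zero_div]
      ring
    rw [this, Finset.sum_range_succ', pow_zero]
    have e : ∑ j ∈ Finset.range k, γ ^ (j + 1) = γ * ∑ j ∈ Finset.range k, γ ^ j := by
      rw [Finset.mul_sum]
      exact Finset.sum_congr rfl fun j _ => by ring
    rw [e]
    nlinarith

theorem tendsto_geom_partial {γ : ℝ} (hγ : 0 ≤ γ) (hγ1 : γ < 1) (c : ℝ) :
    Filter.Tendsto (fun k : ℕ => c * ∑ j ∈ Finset.range k, γ ^ j) Filter.atTop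
      (nhds (c / (1 - γ))) := by
  rw [div_eq_mul_inv]
  exact (hasSum_geometric_of_lt_one hγ hγ1).tendsto_sum_nat.const_mul c

theorem optimalValue_le {G : ℝ → ℝ}
    (hG : ∀ k ℓ u b, 0 ≤ ℓ → ℓ ≤ u → u ≤ 1 → optimalIter F r γ fb k ℓ u b ≤ G ℓ)
    (ℓ u b : ℝ) (h0 : 0 ≤ ℓ) (hu : ℓ ≤ u) (h1 : u ≤ 1) : optimalValue F r γ fb ℓ u b ≤ G ℓ :=
  ciSup_le fun k => hG k ℓ u b h0 hu h1

theorem optimalValue_le_const (hF : MonotoneOn F (Set.Icc 0 1)) (hγ : 0 ≤ γ) (hγ1 : γ < 1)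
    {ρ : ℝ} (hρ : 0 ≤ ρ) (hr : ∀ y ∈ Set.Icc (0 : ℝ) 1, r y ≤ ρ) (ℓ u b : ℝ)
    (h0 : 0 ≤ ℓ) (hu : ℓ ≤ u) (h1 : u ≤ 1) : optimalValue F r γ fb ℓ u b ≤ ρ / (1 - γ) :=
  ciSup_le fun k => optimalIter_le_const hF hγ hγ1 hρ hr k b h0 hu h1

theorem optimalValue_ge (hF : MonotoneOn F (Set.Icc 0 1)) (hγ : 0 ≤ γ) (hγ1 : γ < 1)
    (hr : ∀ y ∈ Set.Icc (0 : ℝ) 1, 0 ≤ r y) {ρ : ℝ} (hρ : ∀ y ∈ Set.Icc (0 : ℝ) 1, r y ≤ ρ)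
    {ℓ u b : ℝ} (h0 : 0 ≤ ℓ) (hu : ℓ ≤ u) (h1 : u ≤ 1) (hlt : F ℓ < F u) (hb : 0 < b) :
    r ℓ / (1 - γ) ≤ optimalValue F r γ fb ℓ u b := by
  have hρ0 : 0 ≤ ρ := (hr 0 (by simp)).trans (hρ 0 (by simp))
  refine le_of_tendsto' (tendsto_geom_partial hγ hγ1 (r ℓ)) fun k => ?_
  refine (optimalIter_ge (fb := fb) hF hγ hγ1 hr hρ h0 hu h1 hlt hb k).trans
    (le_ciSup (f := fun k => optimalIter F r γ fb k ℓ u b) ⟨ρ / (1 - γ), ?_⟩ k)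
  rintro _ ⟨k, rfl⟩
  exact optimalIter_le_const hF hγ hγ1 hρ0 hρ k b h0 hu h1

/-! ### Values of stationary policies -/

theorem policyIter_mem_Icc (hF : MonotoneOn F (Set.Icc 0 1)) (hγ : 0 ≤ γ) (hγ1 : γ < 1)
    (hr : ∀ y ∈ Set.Icc (0 : ℝ) 1, 0 ≤ r y) {ρ : ℝ} (hρ : ∀ y ∈ Set.Icc (0 : ℝ) 1, r y ≤ ρ)
    {y : ℝ → ℝ → ℝ → ℝ}
    (hy : ∀ ℓ u b, 0 ≤ ℓ → ℓ ≤ u → u ≤ 1 → 0 < b → y ℓ u b ∈ Set.Icc ℓ u) (k : ℕ) :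
    ∀ ℓ u b, 0 ≤ ℓ → ℓ ≤ u → u ≤ 1 →
      policyIter F r γ fb y k ℓ u b ∈ Set.Icc 0 (ρ / (1 - γ)) := by
  have hρ0 : 0 ≤ ρ := (hr 0 (by simp)).trans (hρ 0 (by simp))
  have hC : 0 ≤ ρ / (1 - γ) := div_nonneg hρ0 (by linarith)
  induction k with
  | zero => intros; exact ⟨le_rfl, hC⟩
  | succ k ih =>
    intro ℓ u b h0 hu h1
    simp only [policyIter]
    split_ifs with hb
    · obtain ⟨a1, a2⟩ := hy ℓ u b h0 hu h1 hb
      refine ⟨actionValue_nonneg hF hγ hr (fun ℓ u b c1 c2 c3 => (ih ℓ u b c1 c2 c3).1)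
        h0 a1 a2 h1, ?_⟩
      refine (actionValue_le (G := fun _ => ρ / (1 - γ)) hF hγ
        (fun ℓ u b c1 c2 c3 => (ih ℓ u b c1 c2 c3).2) h0 a1 a2 h1).trans
        (le_trans ?_ (const_supersolution (fb := fb) hF hγ1 hρ0 hρ h0 a1 a2 h1))
      have hs := success_weight_nonneg hF h0 a1 a2 h1
      have h2 : γ * (1 - fb.p₁) * policyIter F r γ fb y k ℓ u b ≤
          γ * (1 - fb.p₁) * (ρ / (1 - γ)) :=
        mul_le_mul_of_nonneg_left (ih ℓ u b h0 hu h1).2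
          (mul_nonneg hγ (sub_nonneg.2 fb.p₁_mem.2))
      gcongr
    · exact ⟨le_rfl, hC⟩

theorem policyIter_le_policyValue (hF : MonotoneOn F (Set.Icc 0 1)) (hγ : 0 ≤ γ) (hγ1 : γ < 1)
    (hr : ∀ y ∈ Set.Icc (0 : ℝ) 1, 0 ≤ r y) {ρ : ℝ} (hρ : ∀ y ∈ Set.Icc (0 : ℝ) 1, r y ≤ ρ)
    {y : ℝ → ℝ → ℝ → ℝ}
    (hy : ∀ ℓ u b, 0 ≤ ℓ → ℓ ≤ u → u ≤ 1 → 0 < b → y ℓ u b ∈ Set.Icc ℓ u) (k : ℕ)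
    {ℓ u : ℝ} (b : ℝ) (h0 : 0 ≤ ℓ) (hu : ℓ ≤ u) (h1 : u ≤ 1) :
    policyIter F r γ fb y k ℓ u b ≤ policyValue F r γ fb y ℓ u b := by
  refine le_ciSup (f := fun k => policyIter F r γ fb y k ℓ u b) ⟨ρ / (1 - γ), ?_⟩ k
  rintro _ ⟨k, rfl⟩
  exact (policyIter_mem_Icc hF hγ hγ1 hr hρ hy k ℓ u b h0 hu h1).2

/-- A policy that in the states `(ℓ, 1, b)`, `ℓ ∈ S`, stays in `S`, fails with probability at most
`1 - s` and earns at least `g` on success, has value at least `s g / (1 - s γ)`. -/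
theorem policyValue_ge (hF : MonotoneOn F (Set.Icc 0 1)) (hγ : 0 ≤ γ) (hγ1 : γ < 1)
    (hr : ∀ y ∈ Set.Icc (0 : ℝ) 1, 0 ≤ r y) {ρ : ℝ} (hρ : ∀ y ∈ Set.Icc (0 : ℝ) 1, r y ≤ ρ)
    {y : ℝ → ℝ → ℝ → ℝ}
    (hy : ∀ ℓ u b, 0 ≤ ℓ → ℓ ≤ u → u ≤ 1 → 0 < b → y ℓ u b ∈ Set.Icc ℓ u)
    {b s g : ℝ} (hb : 0 < b) (hs0 : 0 ≤ s) (hs1 : s ≤ 1) (hg : 0 ≤ g) {S : Set ℝ}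
    (hS : S ⊆ Set.Icc 0 1)
    (hstep : ∀ ℓ ∈ S, y ℓ 1 b ∈ S ∧ g ≤ r (y ℓ 1 b) ∧
      s ≤ (F 1 - F (y ℓ 1 b)) / (F 1 - F ℓ)) {ℓ : ℝ} (hℓ : ℓ ∈ S) :
    s * g / (1 - s * γ) ≤ policyValue F r γ fb y ℓ 1 b := by
  -- Failures are credited with nothing. After a success the left end is `ℓ` (signal hidden) or the
  -- action (signal revealed); both lie in `S`, so the induction hypothesis covers either
  -- continuation.
  have key : ∀ k, ∀ ℓ ∈ S, s * g * ∑ j ∈ Finset.range k, (s * γ) ^ j ≤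
      policyIter F r γ fb y k ℓ 1 b := by
    intro k
    induction k with
    | zero => intro ℓ _; simp [policyIter]
    | succ k ih =>
      intro ℓ hℓ
      simp only [policyIter, if_pos hb]
      obtain ⟨c1, c2, c3⟩ := hstep ℓ hℓ
      obtain ⟨l0, l1⟩ := hS hℓ
      obtain ⟨y0, y1⟩ := hy ℓ 1 b l0 l1 le_rfl hb
      have hnn := fun ℓ u b a1 a2 a3 =>
        (policyIter_mem_Icc (fb := fb) hF hγ hγ1 hr hρ hy k ℓ u b a1 a2 a3).1
      have i1 := ih ℓ hℓ
      have i2 := ih _ c1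
      have hf := failure_weight_nonneg hF l0 y0 y1 le_rfl
      have v3 := hnn ℓ (y ℓ 1 b) (b - 1) l0 y0 y1
      have v4 := hnn ℓ 1 (b - 1) l0 l1 le_rfl
      have p1 := fb.p₁_mem
      have p2 := fb.p₂_mem
      have e2 : 0 ≤ 1 - fb.p₂ := by linarith
      have p20 := p2.1
      set T := s * g * ∑ j ∈ Finset.range k, (s * γ) ^ j with hT
      have hT0 : 0 ≤ T := by positivity
      have e : s * g * ∑ j ∈ Finset.range (k + 1), (s * γ) ^ j = s * (g + γ * T) := by
        have e' : ∑ j ∈ Finset.range k, (s * γ) ^ (j + 1) =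
            s * γ * ∑ j ∈ Finset.range k, (s * γ) ^ j := by
          rw [Finset.mul_sum]
          exact Finset.sum_congr rfl fun j _ => by ring
        rw [Finset.sum_range_succ', pow_zero, e', hT]
        ring
      rw [e]
      unfold actionValue
      have j1 : γ * (1 - fb.p₁) * T ≤ γ * (1 - fb.p₁) * policyIter F r γ fb y k ℓ 1 b :=
        mul_le_mul_of_nonneg_left i1 (mul_nonneg hγ (by linarith))
      have j2 : γ * fb.p₁ * T ≤ γ * fb.p₁ * policyIter F r γ fb y k (y ℓ 1 b) 1 b :=
        mul_le_mul_of_nonneg_left i2 (mul_nonneg hγ p1.1)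
      have j3 : g + γ * T ≤ r (y ℓ 1 b) + γ * (1 - fb.p₁) * policyIter F r γ fb y k ℓ 1 b +
          γ * fb.p₁ * policyIter F r γ fb y k (y ℓ 1 b) 1 b := by linarith
      have j4 : 0 ≤ (F (y ℓ 1 b) - F ℓ) / (F 1 - F ℓ) * γ *
          (fb.p₂ * policyIter F r γ fb y k ℓ (y ℓ 1 b) (b - 1) +
            (1 - fb.p₂) * policyIter F r γ fb y k ℓ 1 (b - 1)) := by positivity
      have j5 : s * (g + γ * T) ≤ (F 1 - F (y ℓ 1 b)) / (F 1 - F ℓ) *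
          (r (y ℓ 1 b) + γ * (1 - fb.p₁) * policyIter F r γ fb y k ℓ 1 b +
          γ * fb.p₁ * policyIter F r γ fb y k (y ℓ 1 b) 1 b) :=
        mul_le_mul c3 j3 (by positivity) (hs0.trans c3)
      linarith
  obtain ⟨l0, l1⟩ := hS hℓ
  refine le_of_tendsto' (tendsto_geom_partial (mul_nonneg hs0 hγ) (by nlinarith) (s * g))
    fun k => (key k ℓ hℓ).trans
      (policyIter_le_policyValue hF hγ hγ1 hr hρ hy k b l0 l1 le_rfl)

theorem deltaAction_mem_Icc {δ : ℝ} (hδ : 0 ≤ δ) {ystar : ℝ → ℝ → ℝ → ℝ}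
    (h : IsOptimalAction F r γ fb ystar) (ℓ u b : ℝ) (h0 : 0 ≤ ℓ) (hu : ℓ ≤ u) (h1 : u ≤ 1)
    (hb : 0 < b) : deltaAction δ ystar ℓ u b ∈ Set.Icc ℓ u := by
  unfold deltaAction
  split_ifs with hd
  · refine (h ℓ u b h0 (lt_of_le_of_ne hu ?_) h1 hb).1
    rintro rfl
    simp at hd
    linarith
  · exact ⟨le_rfl, hu⟩

end DecisionProcess

/-! ### Two instances of the decision process -/

/-- The reward function `R + η min (y, a)`. -/
def capReward (R η a y : ℝ) : ℝ := R + η * min y a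

section Instances

variable {F : ℝ → ℝ} {γ R η a : ℝ} {fb : FeedbackModel}

theorem capReward_nonneg (hR : 0 ≤ R) (hη : 0 ≤ η) (ha : 0 ≤ a) :
    ∀ y ∈ Set.Icc (0 : ℝ) 1, 0 ≤ capReward R η a y := fun _ hy =>
  add_nonneg hR (mul_nonneg hη (le_min hy.1 ha))

theorem capReward_le (hη : 0 ≤ η) (y : ℝ) : capReward R η a y ≤ R + η * a := by
  unfold capReward
  gcongr
  exact min_le_right _ _

theorem capReward_mono (hη : 0 ≤ η) : Monotone (capReward R η a) := fun x y h => by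
  unfold capReward
  gcongr

theorem isRewardFunction_capReward {L_r : ℝ} (hR : 0 < R) (hη : 0 ≤ η) (ha : 0 ≤ a)
    (hL : η ≤ L_r) : IsRewardFunction L_r (capReward R η a) := by
  refine ⟨fun y hy => ?_, (capReward_mono hη).monotoneOn _, fun x _ y _ hxy => ?_⟩
  · have := mul_nonneg hη (le_min hy.1 ha)
    unfold capReward
    linarith
  · have h : min y a - min x a ≤ y - x := by
      rcases le_total y a with h | h <;> rcases le_total x a with h' | h' <;>
        simp [h, h'] <;> linarith
    have h2 : 0 ≤ y - x := by linarith
    unfold capReward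
    nlinarith

/-- Where a higher action is never worth its risk, the value of a state is that of its
left end. -/
theorem capReward_supersolution (hF : MonotoneOn F (Set.Icc 0 1)) (hF0 : F 0 = 0)
    (hF1 : F 1 = 1) (hγ : 0 ≤ γ) (hγ1 : γ < 1) (hR : 0 ≤ R) (hη : 0 ≤ η) (ha : 0 ≤ a) {f : ℝ}
    (hf : ∀ x y, 0 ≤ x → x ≤ y → y ≤ 1 → f * (min y a - min x a) ≤ F y - F x)
    {ℓ u y : ℝ} (h0 : 0 ≤ ℓ) (hℓ : ℓ ≤ y) (hu : y ≤ u)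
    (h1 : u ≤ 1) :
    (F u - F y) / (F u - F ℓ) * (capReward R η a y +
          γ * (1 - fb.p₁) * (capReward R η a ℓ / (1 - γ)) +
          γ * fb.p₁ * (capReward R η a y / (1 - γ))) +
        (F y - F ℓ) / (F u - F ℓ) * γ * (capReward R η a ℓ / (1 - γ)) ≤
      capReward R η a y / (1 - γ) - R * f * (min y a - min ℓ a) ∨ F u = F ℓ := by
  by_cases hne : F u = F ℓ
  · exact Or.inr hne
  left
  have hlt : F ℓ < F u := lt_of_le_of_ne
    (hF ⟨h0, by linarith⟩ ⟨by linarith, h1⟩ (hℓ.trans hu)) (Ne.symm hne)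
  have hs := success_weight_nonneg hF h0 hℓ hu h1
  have hq := failure_weight_nonneg hF h0 hℓ hu h1
  have hFℓ : 0 ≤ F ℓ := hF0 ▸ hF ⟨le_rfl, zero_le_one⟩ ⟨h0, by linarith⟩ h0
  have hFu : F u ≤ 1 := hF1 ▸ hF ⟨by linarith, h1⟩ ⟨zero_le_one, le_rfl⟩ h1
  -- The conditioning mass `F u - F ℓ` is at most 1, so conditioning can only increase the failure
  -- probability.
  have hqge : F y - F ℓ ≤ (F y - F ℓ) / (F u - F ℓ) := by
    rw [le_div_iff₀ (by linarith)]
    have : F ℓ ≤ F y := hF ⟨h0, by linarith⟩ ⟨by linarith, by linarith⟩ hℓ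
    nlinarith
  rw [weights_add_eq_one hlt] at hs ⊢
  set q := (F y - F ℓ) / (F u - F ℓ)
  have hm : f * (min y a - min ℓ a) ≤ q := (hf ℓ y h0 hℓ (hu.trans h1)).trans hqge
  have h1γ : 0 < 1 - γ := by linarith
  have hGm : capReward R η a ℓ / (1 - γ) ≤ capReward R η a y / (1 - γ) := by
    have := capReward_mono (R := R) (a := a) hη hℓ
    gcongr
  have hRy : R ≤ capReward R η a y := by
    have := mul_nonneg hη (le_min (h0.trans hℓ) ha)
    unfold capReward
    linarith
  have hGe : capReward R η a y / (1 - γ) =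
      capReward R η a y + γ * (capReward R η a y / (1 - γ)) := by
    field_simp
    ring
  set Gℓ := capReward R η a ℓ / (1 - γ)
  set Gy := capReward R η a y / (1 - γ)
  have p1 := fb.p₁_mem
  have e1 : capReward R η a y + γ * (1 - fb.p₁) * Gℓ + γ * fb.p₁ * Gy ≤ Gy := by
    have : γ * (1 - fb.p₁) * Gℓ ≤ γ * (1 - fb.p₁) * Gy :=
      mul_le_mul_of_nonneg_left hGm (mul_nonneg hγ (by linarith))
    linarith
  have e2 := mul_le_mul_of_nonneg_left e1 hs
  have e3 : γ * Gℓ ≤ γ * Gy := mul_le_mul_of_nonneg_left hGm hγ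
  have e4 := mul_le_mul_of_nonneg_left e3 hq
  have e5 := mul_le_mul_of_nonneg_left hRy hq
  have e6 := mul_le_mul_of_nonneg_left hm hR
  have e7 : q * Gy = q * capReward R η a y + q * (γ * Gy) := by
    rw [← mul_add, ← hGe]
  linarith

/-- Raising the left end by Δ within [0, a] adds at most ηΔ/(1-γ) to all rewards to come, but risks
a round worth R with probability at least fΔ. Under `hRf` the risk is strictly larger, so r(ℓ)/(1-γ)
bounds the optimal value, every maximizer at the initial state is 0, and the δ-policy remains there
for ever. -/
theorem policyValue_ge_of_steep (hF : StrictMonoOn F (Set.Icc 0 1)) (hF0 : F 0 = 0)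
    (hF1 : F 1 = 1) (hγ : 0 ≤ γ) (hγ1 : γ < 1) (hR : 0 ≤ R) (hη : 0 ≤ η) (ha : 0 < a) {f : ℝ}
    (hf : ∀ x y, 0 ≤ x → x ≤ y → y ≤ 1 → f * (min y a - min x a) ≤ F y - F x)
    (hRf : η / (1 - γ) < R * f) {δ B : ℝ} (hδ : 0 ≤ δ) (hδ1 : δ < 1) (hB : 0 < B)
    {ystar : ℝ → ℝ → ℝ → ℝ} (hy : IsOptimalAction F (capReward R η a) γ fb ystar) :
    R / (1 - γ) ≤ policyValue F (capReward R η a) γ fb (deltaAction δ ystar) 0 1 B := by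
  have hFm := hF.monotoneOn
  have hr0 := capReward_nonneg hR hη ha.le
  have hr1 : ∀ y ∈ Set.Icc (0 : ℝ) 1, capReward R η a y ≤ R + η * a := fun y _ =>
    capReward_le hη y
  have h1γ : 0 < 1 - γ := by linarith
  have hr00 : capReward R η a 0 = R := by simp [capReward, ha.le]
  have hV : ∀ ℓ u b, 0 ≤ ℓ → ℓ ≤ u → u ≤ 1 →
      optimalValue F (capReward R η a) γ fb ℓ u b ≤ capReward R η a ℓ / (1 - γ) := by
    refine optimalValue_le (G := fun ℓ => capReward R η a ℓ / (1 - γ)) fun k =>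
      optimalIter_le hFm hγ (fun ℓ hℓ => div_nonneg (hr0 ℓ hℓ) h1γ.le) ?_ k
    intro ℓ u y h0 hℓ hu h1
    rcases capReward_supersolution (fb := fb) hFm hF0 hF1 hγ hγ1 hR hη ha.le hf
      h0 hℓ hu h1 with h | h
    · refine h.trans ?_
      have hm : 0 ≤ min y a - min ℓ a := sub_nonneg.2 (min_le_min_right _ hℓ)
      have := mul_le_mul_of_nonneg_right hRf.le hm
      have e : capReward R η a y / (1 - γ) - capReward R η a ℓ / (1 - γ) =
          η / (1 - γ) * (min y a - min ℓ a) := by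
        unfold capReward
        field_simp
        ring
      linarith
    -- On an interval without mass both weights are 0 by the convention for division by zero.
    · simp only [h, sub_self, div_zero, zero_mul, add_zero]
      exact div_nonneg (hr0 ℓ ⟨h0, by linarith⟩) h1γ.le
  have hS := optimalValue_ge (fb := fb) hFm hγ hγ1 hr0 hr1 le_rfl zero_le_one le_rfl
    (by rw [hF0, hF1]; norm_num) hB
  obtain ⟨⟨y0, y1⟩, hmax⟩ := hy 0 1 B le_rfl zero_lt_one le_rfl hB
  have hzero : ystar 0 1 B = 0 := by
    by_contra hne
    have hpos : 0 < ystar 0 1 B := lt_of_le_of_ne y0 (Ne.symm hne)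
    have hcmp := hmax (show (0 : ℝ) ∈ Set.Icc (0 : ℝ) 1 by simp)
    simp only [Set.mem_ofPred_eq] at hcmp
    have e0 : actionValue F (capReward R η a) γ fb (optimalValue F (capReward R η a) γ fb)
        0 1 B 0 = R + γ * optimalValue F (capReward R η a) γ fb 0 1 B := by
      unfold actionValue
      rw [hF0, hF1, hr00]
      ring
    have e1 := actionValue_le (r := capReward R η a) (fb := fb) hFm hγ hV (b := B)
      le_rfl y0 y1 le_rfl
    have hSe : optimalValue F (capReward R η a) γ fb 0 1 B = capReward R η a 0 / (1 - γ) :=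
      le_antisymm (hV 0 1 B le_rfl zero_le_one le_rfl) hS
    rw [hSe] at e0 e1
    rcases capReward_supersolution (fb := fb) hFm hF0 hF1 hγ hγ1 hR hη ha.le hf
      le_rfl y0 y1 le_rfl with h | h
    · have hm : 0 < min (ystar 0 1 B) a := lt_min hpos ha
      have h2 := mul_lt_mul_of_pos_right hRf hm
      have e : capReward R η a (ystar 0 1 B) / (1 - γ) - R / (1 - γ) =
          η / (1 - γ) * min (ystar 0 1 B) a := by
        unfold capReward
        field_simp
        ring
      have e3 : R / (1 - γ) = R + γ * (R / (1 - γ)) := by field_simp; ring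
      have e4 : min (0 : ℝ) a = 0 := min_eq_left ha.le
      rw [e4, sub_zero] at h
      rw [hr00] at e0 e1 h
      linarith
    · rw [hF0, hF1] at h
      norm_num at h
  have hd : deltaAction δ ystar 0 1 B = 0 := by
    simp [deltaAction, hδ1, hzero]
  have := policyValue_ge (fb := fb) (s := 1) (g := R) (S := {0}) hFm hγ hγ1 hr0 hr1
    (deltaAction_mem_Icc hδ hy) hB zero_le_one le_rfl hR (by simp) (by
      rintro ℓ rfl
      rw [hd]
      refine ⟨rfl, hr00.ge, ?_⟩
      rw [div_self]
      rw [hF0, hF1]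
      norm_num) (Set.mem_singleton 0)
  simpa using this

/-- The comparison of an action that fails with probability `q` and earns `v` on success with
one that fails with probability at most `ε` and earns the maximal reward `ρ`. -/
theorem near_optimal_of_comparison {γ R ρ v q qx ε C X : ℝ} (hR : 0 < R) (hRρ : R ≤ ρ)
    (hry : v ≤ ρ) (hε : 0 ≤ ε) (hqx : qx ≤ ε) (hq0 : 0 ≤ q) (hq1 : q ≤ 1) (hCe : C = ρ + γ * C)
    (hX0 : 0 ≤ X) (hXC' : X ≤ γ * C) (hXC : γ * C - X ≤ R / 2)
    (main : (1 - qx) * (ρ + X) ≤ (1 - q) * (v + X) + q * γ * C)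
    (hεR : 2 * ε * C / R ≤ 1 / 2) : ρ - 2 * ε * C ≤ v ∧ q ≤ 2 * ε * C / R := by
  have m1 : (1 - ε) * (ρ + X) ≤ (1 - qx) * (ρ + X) :=
    mul_le_mul_of_nonneg_right (by linarith) (by linarith)
  have m2 : ε * (ρ + X) ≤ ε * C := mul_le_mul_of_nonneg_left (by linarith) hε
  have m3 : q * (R / 2) ≤ q * (ρ + X - γ * C) := by
    exact mul_le_mul_of_nonneg_left (by linarith) hq0
  have m4 : 0 ≤ (1 - q) * (ρ - v) :=
    mul_nonneg (by linarith) (by linarith)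
  have m5 : (1 - q) * (ρ - v) + q * (ρ + X - γ * C) ≤ ε * C := by
    linarith
  have hqle : q ≤ 2 * ε * C / R := by
    rw [le_div_iff₀ hR]
    linarith
  refine ⟨?_, hqle⟩
  have m6 : 0 ≤ q * (R / 2) := by positivity
  have m7 : 1 / 2 * (ρ - v) ≤
      (1 - q) * (ρ - v) :=
    mul_le_mul_of_nonneg_right (by linarith) (by linarith)
  linarith

/-- Conditioning on a threshold above `ℓ` only lowers the chance that it lies below `a`. -/
theorem failure_weight_max_le (hF : MonotoneOn F (Set.Icc 0 1)) (hF1 : F 1 = 1) (ha : 0 ≤ a)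
    (ha1 : a ≤ 1) {ε ℓ : ℝ} (hFa : F a ≤ ε) (hε : 0 ≤ ε)
    (hFℓ0 : 0 ≤ F ℓ) (hFℓ1 : F ℓ < F 1) : (F (max a ℓ) - F ℓ) / (F 1 - F ℓ) ≤ ε := by
  rw [hF1] at hFℓ1
  rw [div_le_iff₀ (by linarith), hF1]
  rcases le_total a ℓ with h | h
  · rw [max_eq_right h]
    nlinarith
  · rw [max_eq_left h]
    by_cases hε1 : ε ≤ 1
    · nlinarith
    · have := hF ⟨ha, ha1⟩ (show (1 : ℝ) ∈ Set.Icc (0 : ℝ) 1 by simp) ha1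
      nlinarith

-- The action max(a, ℓ) earns the maximal reward and fails with probability at most ε. A maximizer
-- must do at least as well although a failure costs it at least R/2; hence it is almost safe and
-- almost maximally rewarded.
set_option maxHeartbeats 400000 in
theorem optimal_step_of_flat (hF : StrictMonoOn F (Set.Icc 0 1)) (hF0 : F 0 = 0)
    (hF1 : F 1 = 1) (hγ : 0 ≤ γ) (hγ1 : γ < 1) (hR : 0 < R) (hη : 0 ≤ η) (ha : 0 < a)
    (ha1 : a < 1) {ε : ℝ} (hε : 0 ≤ ε) (hFa : F a ≤ ε) (hRa : 2 * (η * a / (1 - γ)) ≤ R)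
    (hεR : 2 * ε * ((R + η * a) / (1 - γ)) / R ≤ 1 / 2) {B : ℝ} (hB : 0 < B)
    {ystar : ℝ → ℝ → ℝ → ℝ} (hy : IsOptimalAction F (capReward R η a) γ fb ystar)
    {ℓ : ℝ} (h0 : 0 ≤ ℓ) (h1 : ℓ < 1) :
    R + η * a - 2 * ε * ((R + η * a) / (1 - γ)) ≤ capReward R η a (ystar ℓ 1 B) ∧
      1 - 2 * ε * ((R + η * a) / (1 - γ)) / R ≤
        (F 1 - F (ystar ℓ 1 B)) / (F 1 - F ℓ) := by
  have hFm := hF.monotoneOn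
  have hr0 := capReward_nonneg hR.le hη ha.le
  have hr1 : ∀ y ∈ Set.Icc (0 : ℝ) 1, capReward R η a y ≤ R + η * a := fun y _ =>
    capReward_le hη y
  have h1γ : 0 < 1 - γ := by linarith
  have hra : 0 ≤ R + η * a := by positivity
  have hone : (1 : ℝ) ∈ Set.Icc (0 : ℝ) 1 := by simp
  have hFℓ1 : F ℓ < F 1 := hF ⟨h0, h1.le⟩ hone h1
  have hFℓ0 : 0 ≤ F ℓ := hF0 ▸ hFm ⟨le_rfl, zero_le_one⟩ ⟨h0, h1.le⟩ h0
  obtain ⟨⟨y0, y1⟩, hmax⟩ := hy ℓ 1 B h0 h1 le_rfl hB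
  set y := ystar ℓ 1 B
  set x := max a ℓ with hx
  have hx1 : x < 1 := max_lt ha1 h1
  have hxℓ : ℓ ≤ x := le_max_right _ _
  have hx0 : 0 ≤ x := h0.trans hxℓ
  have hrx : capReward R η a x = R + η * a := by
    simp [capReward, hx]
  set V := optimalValue F (capReward R η a) γ fb with hVdef
  have hVle := optimalValue_le_const (fb := fb) hFm hγ hγ1 hra hr1
  have hVx := optimalValue_ge (fb := fb) hFm hγ hγ1 hr0 hr1 hx0 hx1.le le_rfl
    (hF ⟨hx0, hx1.le⟩ hone hx1) hB
  have hSge := optimalValue_ge (fb := fb) hFm hγ hγ1 hr0 hr1 h0 h1.le le_rfl hFℓ1 hB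
  have hSle := hVle ℓ 1 B h0 h1.le le_rfl
  rw [hrx] at hVx
  have hVnn := optimalValue_nonneg (fb := fb) hFm hγ hr0
  have hcmp := hmax (show x ∈ Set.Icc ℓ 1 from ⟨hxℓ, hx1.le⟩)
  simp only [Set.mem_ofPred_eq] at hcmp
  have hup := actionValue_le (r := capReward R η a) (fb := fb)
    (G := fun _ => (R + η * a) / (1 - γ)) hFm hγ hVle (b := B) h0 y0 y1 le_rfl
  have hp1 := fb.p₁_mem
  have hp2 := fb.p₂_mem
  have hqx : (F x - F ℓ) / (F 1 - F ℓ) ≤ ε :=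
    failure_weight_max_le hFm hF1 ha.le ha1.le hFa hε hFℓ0 hFℓ1
  have hlow : (1 - (F x - F ℓ) / (F 1 - F ℓ)) * (R + η * a + γ * (1 - fb.p₁) * V ℓ 1 B +
      γ * fb.p₁ * ((R + η * a) / (1 - γ))) ≤
        actionValue F (capReward R η a) γ fb V ℓ 1 B x := by
    have hs := success_weight_nonneg hFm h0 hxℓ hx1.le le_rfl
    have hq := failure_weight_nonneg hFm h0 hxℓ hx1.le le_rfl
    unfold actionValue
    rw [← weights_add_eq_one hFℓ1, hrx]
    have v3 := hVnn ℓ x (B - 1) h0 hxℓ hx1.le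
    have v4 := hVnn ℓ 1 (B - 1) h0 h1.le le_rfl
    have j2 : γ * fb.p₁ * ((R + η * a) / (1 - γ)) ≤ γ * fb.p₁ * V x 1 B :=
      mul_le_mul_of_nonneg_left hVx (mul_nonneg hγ hp1.1)
    have e2 : 0 ≤ 1 - fb.p₂ := by linarith
    have p20 := hp2.1
    have j4 : 0 ≤ (F x - F ℓ) / (F 1 - F ℓ) * γ *
          (fb.p₂ * V ℓ x (B - 1) + (1 - fb.p₂) * V ℓ 1 (B - 1)) := by
      have : 0 ≤ fb.p₂ * V ℓ x (B - 1) := mul_nonneg p20 v3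
      have : 0 ≤ (1 - fb.p₂) * V ℓ 1 (B - 1) := mul_nonneg e2 v4
      positivity
    have j5 := mul_le_mul_of_nonneg_left
      (show R + η * a + γ * (1 - fb.p₁) * V ℓ 1 B + γ * fb.p₁ * ((R + η * a) / (1 - γ)) ≤
        R + η * a + γ * (1 - fb.p₁) * V ℓ 1 B + γ * fb.p₁ * V x 1 B by linarith) hs
    linarith
  rw [weights_add_eq_one hFℓ1] at hup ⊢
  have hq0 := failure_weight_nonneg hFm h0 y0 y1 le_rfl
  have hry := capReward_le (R := R) (a := a) hη y
  change capReward R η a ℓ / (1 - γ) ≤ V ℓ 1 B at hSge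
  change V ℓ 1 B ≤ _ at hSle
  set qx := (F x - F ℓ) / (F 1 - F ℓ)
  set q := (F y - F ℓ) / (F 1 - F ℓ)
  set S := V ℓ 1 B
  set C := (R + η * a) / (1 - γ) with hC
  have hC0 : 0 ≤ C := by positivity
  have hCe : C = R + η * a + γ * C := by rw [hC]; field_simp; ring
  have hc0 : C - S ≤ η * a / (1 - γ) := by
    have : R / (1 - γ) ≤ capReward R η a ℓ / (1 - γ) := by
      have : R ≤ capReward R η a ℓ := by
        have := mul_nonneg hη (le_min h0 ha.le)
        unfold capReward
        linarith
      gcongr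
    have e : C = R / (1 - γ) + η * a / (1 - γ) := by rw [hC, add_div]
    linarith
  -- The continuation after a success: `S` if the signal is hidden, and at best `C` if it is
  -- revealed. The comparison action `x` attains this.
  set X := γ * (1 - fb.p₁) * S + γ * fb.p₁ * C with hX
  have hXC : γ * C - X ≤ R / 2 := by
    have e : γ * C - X = γ * (1 - fb.p₁) * (C - S) := by rw [hX]; ring
    have e2 : γ * (1 - fb.p₁) ≤ 1 := mul_le_one₀ hγ1.le (by linarith) (by linarith)
    have e3 : 0 ≤ γ * (1 - fb.p₁) := mul_nonneg hγ (by linarith)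
    have e4 : γ * (1 - fb.p₁) * (C - S) ≤ 1 * (C - S) :=
      mul_le_mul_of_nonneg_right e2 (by linarith)
    linarith
  have hXC' : X ≤ γ * C := by
    have e : γ * C - X = γ * (1 - fb.p₁) * (C - S) := by rw [hX]; ring
    have e3 : 0 ≤ γ * (1 - fb.p₁) * (C - S) :=
      mul_nonneg (mul_nonneg hγ (by linarith)) (by linarith)
    linarith
  have hS0 : 0 ≤ S := hVnn ℓ 1 B h0 h1.le le_rfl
  have hX0 : 0 ≤ X :=
    add_nonneg (mul_nonneg (mul_nonneg hγ (by linarith)) hS0)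
      (mul_nonneg (mul_nonneg hγ hp1.1) hC0)
  have main : (1 - qx) * (R + η * a + X) ≤
      (1 - q) * (capReward R η a y + X) + q * γ * C := by
    have := (hlow.trans hcmp).trans hup
    rw [hX]
    linarith
  have hq1 : q ≤ 1 := by
    have := success_weight_nonneg hFm h0 y0 y1 le_rfl
    rw [weights_add_eq_one hFℓ1] at this
    linarith
  have := near_optimal_of_comparison hR (le_add_of_nonneg_right (mul_nonneg hη ha.le))
    hry hε hqx hq0 hq1 hCe hX0 hXC' hXC main hεR
  exact ⟨this.1, by linarith⟩

/-- `policyValue_ge` is applied to the left ends that are 0 or have almost maximal reward. This set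
is stable under optimal steps, and it also covers the safe action taken when 1 - ℓ ≤ δ: that case
excludes ℓ = 0 because δ < 1, so the safe action itself is well rewarded. -/
theorem policyValue_ge_of_flat (hF : StrictMonoOn F (Set.Icc 0 1)) (hF0 : F 0 = 0)
    (hF1 : F 1 = 1) (hγ : 0 ≤ γ) (hγ1 : γ < 1) (hR : 0 < R) (hη : 0 ≤ η) (ha : 0 < a)
    (ha1 : a < 1) {ε : ℝ} (hε : 0 ≤ ε) (hFa : F a ≤ ε) (hRa : 2 * (η * a / (1 - γ)) ≤ R)
    (hεR : 2 * ε * ((R + η * a) / (1 - γ)) / R ≤ 1 / 2) {δ B : ℝ} (hδ : 0 ≤ δ) (hδ1 : δ < 1)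
    (hB : 0 < B) {ystar : ℝ → ℝ → ℝ → ℝ}
    (hy : IsOptimalAction F (capReward R η a) γ fb ystar) :
    (1 - 2 * ε * ((R + η * a) / (1 - γ)) / R) *
        (R + η * a - 2 * ε * ((R + η * a) / (1 - γ))) /
        (1 - (1 - 2 * ε * ((R + η * a) / (1 - γ)) / R) * γ) ≤
      policyValue F (capReward R η a) γ fb (deltaAction δ ystar) 0 1 B := by
  have hFm := hF.monotoneOn
  have hr0 := capReward_nonneg hR.le hη ha.le
  have hr1 : ∀ y ∈ Set.Icc (0 : ℝ) 1, capReward R η a y ≤ R + η * a := fun y _ =>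
    capReward_le hη y
  have h1γ : 0 < 1 - γ := by linarith
  have hq0 : 0 ≤ 2 * ε * ((R + η * a) / (1 - γ)) / R := by positivity
  set C := (R + η * a) / (1 - γ) with hC
  have hg : 2 * ε * C ≤ R / 2 := by
    rw [div_le_iff₀ hR] at hεR
    linarith
  have hηa : 0 ≤ η * a := by positivity
  refine policyValue_ge (fb := fb) (ℓ := 0)
    (S := {ℓ | 0 ≤ ℓ ∧ ℓ < 1 ∧ (ℓ = 0 ∨ R + η * a - 2 * ε * C ≤ capReward R η a ℓ)})
    hFm hγ hγ1 hr0 hr1 (deltaAction_mem_Icc hδ hy) hB (by linarith) (by linarith)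
    (by linarith) (fun ℓ h => ⟨h.1, h.2.1.le⟩) ?_ ⟨le_rfl, zero_lt_one, Or.inl rfl⟩
  rintro ℓ ⟨h0, h1, hℓ⟩
  have hmem := deltaAction_mem_Icc hδ hy ℓ 1 B h0 h1.le le_rfl hB
  have hone : (1 : ℝ) ∈ Set.Icc (0 : ℝ) 1 := by simp
  have hFℓ1 : F ℓ < F 1 := hF ⟨h0, h1.le⟩ hone h1
  have main : R + η * a - 2 * ε * C ≤ capReward R η a (deltaAction δ ystar ℓ 1 B) ∧
      1 - 2 * ε * C / R ≤ (F 1 - F (deltaAction δ ystar ℓ 1 B)) / (F 1 - F ℓ) := by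
    unfold deltaAction
    split_ifs with hd
    · exact optimal_step_of_flat hF hF0 hF1 hγ hγ1 hR hη ha ha1 hε hFa hRa hεR hB hy h0 h1
    · refine ⟨?_, ?_⟩
      · rcases hℓ with rfl | h
        · simp at hd
          linarith
        · exact h
      · rw [div_self (by linarith)]
        linarith
  refine ⟨⟨h0.trans hmem.1, ?_, Or.inr main.1⟩, main.1, main.2⟩
  -- The action 1 has success weight 0, whereas the weight just obtained is at least 1/2.
  refine lt_of_le_of_ne hmem.2 fun h => ?_
  have := main.2
  rw [h, sub_self, zero_div] at this
  linarith

end Instances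

/-! ### A family of threshold laws -/

/-- The uniform law on `(0, a)`. -/
def lowLaw (a : ℝ) : Measure ℝ := ENNReal.ofReal (1 / a) • volume.restrict (Set.Ioo 0 a)

/-- The uniform law on `[a, 1)`. -/
def highLaw (a : ℝ) : Measure ℝ := ENNReal.ofReal (1 / (1 - a)) • volume.restrict (Set.Ico a 1)

/-- The mixture of the uniform laws on `[a, 1)` and `(0, a)` with weights `1 - ε` and `ε`. -/
def mixedLaw (a ε : ℝ) : Measure ℝ :=
  ENNReal.ofReal (1 - ε) • highLaw a + ENNReal.ofReal ε • lowLaw a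

theorem isProbabilityMeasure_lowLaw {a : ℝ} (ha : 0 < a) : IsProbabilityMeasure (lowLaw a) :=
  ⟨by
    simp only [lowLaw, Measure.smul_apply, Measure.restrict_apply_univ, Real.volume_Ioo,
      sub_zero, smul_eq_mul]
    rw [← ENNReal.ofReal_mul (by positivity), one_div_mul_cancel ha.ne', ENNReal.ofReal_one]⟩

theorem isProbabilityMeasure_highLaw {a : ℝ} (ha : a < 1) : IsProbabilityMeasure (highLaw a) :=
  ⟨by
    have h : 0 < 1 - a := by linarith
    simp only [highLaw, Measure.smul_apply, Measure.restrict_apply_univ, Real.volume_Ico,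
      smul_eq_mul]
    rw [← ENNReal.ofReal_mul (by positivity), one_div_mul_cancel h.ne', ENNReal.ofReal_one]⟩

theorem isProbabilityMeasure_mixedLaw {a ε : ℝ} (ha : 0 < a) (ha1 : a < 1) (hε : 0 ≤ ε)
    (hε1 : ε ≤ 1) : IsProbabilityMeasure (mixedLaw a ε) := by
  have := isProbabilityMeasure_lowLaw ha
  have := isProbabilityMeasure_highLaw ha1
  refine ⟨?_⟩
  simp only [mixedLaw, Measure.add_apply, Measure.smul_apply, measure_univ, smul_eq_mul, mul_one]
  rw [← ENNReal.ofReal_add (by linarith) hε]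
  simp

theorem mixedLaw_Ioo {a ε : ℝ} (ha : 0 < a) (ha1 : a < 1) (hε : 0 ≤ ε) (hε1 : ε ≤ 1) :
    mixedLaw a ε (Set.Ioo 0 1) = 1 := by
  have h1 : lowLaw a (Set.Ioo 0 1) = 1 := by
    have := isProbabilityMeasure_lowLaw ha
    rw [← measure_univ (μ := lowLaw a)]
    simp only [lowLaw, Measure.smul_apply, Measure.restrict_apply measurableSet_Ioo,
      Measure.restrict_apply_univ]
    rw [Set.inter_eq_right.2 (Set.Ioo_subset_Ioo_right ha1.le)]
  have h2 : highLaw a (Set.Ioo 0 1) = 1 := by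
    have := isProbabilityMeasure_highLaw ha1
    rw [← measure_univ (μ := highLaw a)]
    simp only [highLaw, Measure.smul_apply, Measure.restrict_apply measurableSet_Ioo,
      Measure.restrict_apply_univ]
    rw [Set.inter_eq_right.2 (show Set.Ico a 1 ⊆ Set.Ioo 0 1 from
      fun x hx => ⟨ha.trans_le hx.1, hx.2⟩)]
  simp only [mixedLaw, Measure.add_apply, Measure.smul_apply, h1, h2, smul_eq_mul, mul_one]
  rw [← ENNReal.ofReal_add (by linarith) hε]
  simp

theorem cdf_mixedLaw {a ε : ℝ} (ha : 0 < a) (ha1 : a < 1) (hε : 0 ≤ ε) (hε1 : ε ≤ 1)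
    {y : ℝ} (hy : y ∈ Set.Icc (0 : ℝ) 1) :
    cdf (mixedLaw a ε) y = ε / a * min y a + (1 - ε) / (1 - a) * (y - min y a) := by
  have := isProbabilityMeasure_mixedLaw ha ha1 hε hε1
  have h1a : 0 < 1 - a := by linarith
  have hlow : lowLaw a (Set.Iic y) = ENNReal.ofReal (1 / a * min y a) := by
    simp only [lowLaw, Measure.smul_apply, Measure.restrict_apply measurableSet_Iic, smul_eq_mul]
    rw [ENNReal.ofReal_mul (by positivity)]
    congr 1
    rcases lt_or_ge y a with h | h
    · have : Set.Iic y ∩ Set.Ioo 0 a = Set.Ioc 0 y := by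
        ext x
        simp only [Set.mem_inter_iff, Set.mem_Iic, Set.mem_Ioo, Set.mem_Ioc]
        constructor
        · tauto
        · intro hx; exact ⟨hx.2, hx.1, hx.2.trans_lt h⟩
      rw [this, Real.volume_Ioc, min_eq_left h.le, sub_zero]
    · rw [Set.inter_eq_right.2 (show Set.Ioo 0 a ⊆ Set.Iic y from
        fun x hx => hx.2.le.trans h), Real.volume_Ioo,
        min_eq_right h, sub_zero]
  have hhigh : highLaw a (Set.Iic y) = ENNReal.ofReal (1 / (1 - a) * (y - min y a)) := by
    simp only [highLaw, Measure.smul_apply, Measure.restrict_apply measurableSet_Iic, smul_eq_mul]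
    rw [ENNReal.ofReal_mul (by positivity)]
    congr 1
    rcases lt_or_eq_of_le hy.2 with h | h
    · have : Set.Iic y ∩ Set.Ico a 1 = Set.Icc a y := by
        ext x
        simp only [Set.mem_inter_iff, Set.mem_Iic, Set.mem_Ico, Set.mem_Icc]
        constructor
        · tauto
        · intro hx; exact ⟨hx.2, hx.1, hx.2.trans_lt h⟩
      rw [this, Real.volume_Icc]
      rcases le_total y a with h' | h'
      · rw [min_eq_left h', sub_self, ENNReal.ofReal_zero, ENNReal.ofReal_eq_zero]
        linarith
      · rw [min_eq_right h']
    · rw [h, Set.inter_eq_right.2 (show Set.Ico a 1 ⊆ Set.Iic 1 from fun x hx => hx.2.le), Real.volume_Ico,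
        min_eq_right ha1.le]
  have hm : 0 ≤ min y a := le_min hy.1 ha.le
  have hm' : 0 ≤ y - min y a := sub_nonneg.2 (min_le_left _ _)
  have hε' : 0 ≤ 1 - ε := by linarith
  rw [cdf_eq_real, measureReal_def]
  simp only [mixedLaw, Measure.add_apply, Measure.smul_apply, hlow, hhigh, smul_eq_mul]
  rw [← ENNReal.ofReal_mul hε', ← ENNReal.ofReal_mul hε,
    ← ENNReal.ofReal_add (by positivity) (by positivity), ENNReal.toReal_ofReal (by positivity)]
  ring

theorem isThresholdLaw_mixedLaw {a ε L_h : ℝ} (ha : 0 < a) (ha1 : a < 1) (hε : 0 < ε)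
    (hε1 : ε < 1) (h1 : ε / a ≤ L_h) (h2 : 1 / (1 - a) ≤ L_h) :
    IsThresholdLaw L_h (mixedLaw a ε) := by
  have h1a : 0 < 1 - a := by linarith
  have hε' : 0 < 1 - ε := by linarith
  refine ⟨isProbabilityMeasure_mixedLaw ha ha1 hε.le hε1.le, mixedLaw_Ioo ha ha1 hε.le hε1.le,
    min (ε / a) ((1 - ε) / (1 - a)), lt_min (by positivity) (by positivity), ?_⟩
  intro x hx y hy hxy
  rw [cdf_mixedLaw ha ha1 hε.le hε1.le hx, cdf_mixedLaw ha ha1 hε.le hε1.le hy]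
  have m1 : 0 ≤ min y a - min x a := sub_nonneg.2 (min_le_min_right _ hxy)
  have m2 : 0 ≤ (y - min y a) - (x - min x a) := by
    rcases le_total y a with h | h <;> rcases le_total x a with h' | h' <;>
      simp [h, h'] <;> linarith
  have h3 : (1 - ε) / (1 - a) ≤ L_h := le_trans (by gcongr; linarith) h2
  have l1 := mul_le_mul_of_nonneg_right (min_le_left (ε / a) ((1 - ε) / (1 - a))) m1
  have l2 := mul_le_mul_of_nonneg_right (min_le_right (ε / a) ((1 - ε) / (1 - a))) m2
  have u1 := mul_le_mul_of_nonneg_right h1 m1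
  have u2 := mul_le_mul_of_nonneg_right h3 m2
  constructor <;> linarith

theorem strictMonoOn_cdf {L_h : ℝ} {μ : Measure ℝ} (h : IsThresholdLaw L_h μ) :
    StrictMonoOn (cdf μ) (Set.Icc 0 1) := by
  obtain ⟨-, -, c, hc, h⟩ := h
  intro x hx y hy hxy
  have := (h x hx y hy hxy.le).1
  have : 0 < c * (y - x) := mul_pos hc (by linarith)
  linarith

theorem cdf_mixedLaw_zero {a ε : ℝ} (ha : 0 < a) (ha1 : a < 1) (hε : 0 ≤ ε) (hε1 : ε ≤ 1) :
    cdf (mixedLaw a ε) 0 = 0 := by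
  rw [cdf_mixedLaw ha ha1 hε hε1 (by simp), min_eq_left ha.le]
  ring

theorem cdf_mixedLaw_one {a ε : ℝ} (ha : 0 < a) (ha1 : a < 1) (hε : 0 ≤ ε) (hε1 : ε ≤ 1) :
    cdf (mixedLaw a ε) 1 = 1 := by
  have h1a : 1 - a ≠ 0 := by linarith
  rw [cdf_mixedLaw ha ha1 hε hε1 (by simp), min_eq_right ha1.le]
  field_simp
  ring

theorem cdf_mixedLaw_break {a ε : ℝ} (ha : 0 < a) (ha1 : a < 1) (hε : 0 ≤ ε) (hε1 : ε ≤ 1) :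
    cdf (mixedLaw a ε) a = ε := by
  rw [cdf_mixedLaw ha ha1 hε hε1 ⟨ha.le, ha1.le⟩, min_self]
  field_simp
  ring

theorem cdf_mixedLaw_sub_ge {a ε : ℝ} (ha : 0 < a) (ha1 : a < 1) (hε : 0 ≤ ε) (hε1 : ε ≤ 1)
    {x y : ℝ} (hx : 0 ≤ x) (hxy : x ≤ y) (hy : y ≤ 1) :
    ε / a * (min y a - min x a) ≤ cdf (mixedLaw a ε) y - cdf (mixedLaw a ε) x := by
  have h1a : 0 < 1 - a := by linarith
  have hε' : 0 ≤ 1 - ε := by linarith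
  rw [cdf_mixedLaw ha ha1 hε hε1 ⟨hx, hxy.trans hy⟩,
    cdf_mixedLaw ha ha1 hε hε1 ⟨hx.trans hxy, hy⟩]
  have m2 : 0 ≤ (y - min y a) - (x - min x a) := by
    rcases le_total y a with h | h <;> rcases le_total x a with h' | h' <;>
      simp [h, h'] <;> linarith
  have : 0 ≤ (1 - ε) / (1 - a) * ((y - min y a) - (x - min x a)) := by positivity
  linarith

/-- Restricted to thresholds above `a`, the laws of `N` independent thresholds are proportional. -/
theorem smul_pi_highLaw_le {N : ℕ} {a ε : ℝ} (ha : 0 < a) (ha1 : a < 1) (hε : 0 ≤ ε)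
    (hε1 : ε ≤ 1) :
    ENNReal.ofReal ((1 - ε) ^ N) • Measure.pi (fun _ : Fin N => highLaw a) ≤
      Measure.pi fun _ : Fin N => mixedLaw a ε := by
  have := isProbabilityMeasure_mixedLaw ha ha1 hε hε1
  have := isProbabilityMeasure_highLaw ha1
  -- Cutting the mixture at `a` leaves its high component; its weight 1-ε produces the factor
  -- (1-ε)^N in the product.
  have hres : (mixedLaw a ε).restrict (Set.Ici a) = ENNReal.ofReal (1 - ε) • highLaw a := by
    have h1 : (lowLaw a).restrict (Set.Ici a) = 0 := by
      rw [Measure.restrict_eq_zero, lowLaw, Measure.smul_apply,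
        Measure.restrict_apply measurableSet_Ici]
      have : Set.Ici a ∩ Set.Ioo 0 a = ∅ := by
        ext x
        simp only [Set.mem_inter_iff, Set.mem_Ici, Set.mem_Ioo, Set.mem_empty_iff_false,
          iff_false]
        intro h
        linarith [h.1, h.2.2]
      simp [this]
    have h2 : (highLaw a).restrict (Set.Ici a) = highLaw a := by
      rw [highLaw, Measure.restrict_smul, Measure.restrict_restrict measurableSet_Ici,
        Set.inter_eq_right.2 (show Set.Ico a 1 ⊆ Set.Ici a from fun x hx => hx.1)]
    rw [mixedLaw, Measure.restrict_add, Measure.restrict_smul, Measure.restrict_smul, h1, h2]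
    simp
  have hpi : Measure.pi (fun _ : Fin N => ENNReal.ofReal (1 - ε) • highLaw a) =
      ENNReal.ofReal ((1 - ε) ^ N) • Measure.pi (fun _ : Fin N => highLaw a) := by
    have : IsFiniteMeasure (ENNReal.ofReal (1 - ε) • highLaw a) := by
      rw [← hres]; infer_instance
    refine Measure.pi_eq fun s hs => ?_
    simp only [Measure.smul_apply, Measure.pi_pi, smul_eq_mul]
    rw [Finset.prod_mul_distrib, ENNReal.ofReal_pow (by linarith)]
    simp
  rw [← hpi, ← hres, ← Measure.restrict_pi_pi]
  exact Measure.restrict_le_self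

/-! ### Discounted sums along the rounds with one user -/

section Rounds

variable {act : ℕ → Prop} [DecidablePred act] {t : ℕ → ℕ} {γ : ℝ}

/-- The counter advances exactly at the active steps, so these contribute the consecutive powers 1,
γ, γ², …. -/
theorem sum_discount_rounds (hγ1 : γ < 1) (h0 : t 0 = 0)
    (ht : ∀ k, t (k + 1) = if act k then t k + 1 else t k) (K : ℕ) :
    ∑ k ∈ Finset.range K, (if act k then γ ^ t k else 0) = (1 - γ ^ t K) / (1 - γ) := by
  have h1 : (1 - γ) ≠ 0 := by linarith
  induction K with
  | zero => simp [h0]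
  | succ K ih =>
    rw [Finset.sum_range_succ, ih, ht]
    split_ifs
    · rw [pow_succ]
      field_simp
      ring
    · simp

/-- Summation by parts against the running maximum `m` of `v`. -/
theorem discounted_sum_le_sum_increments (hγ : 0 ≤ γ) (hγ1 : γ < 1) {v m : ℕ → ℝ}
    (ht : ∀ k, t (k + 1) = if act k then t k + 1 else t k) (hm0 : m 0 = 0)
    (hm : ∀ k, m (k + 1) = if act k then max (m k) (v k) else m k) (K : ℕ) :
    (1 - γ) * ∑ k ∈ Finset.range K, (if act k then γ ^ t k * v k else 0) + γ ^ t K * m K ≤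
      ∑ k ∈ Finset.range K, γ ^ t k * (m (k + 1) - m k) := by
  induction K with
  | zero => simp [hm0]
  | succ K ih =>
    rw [Finset.sum_range_succ, Finset.sum_range_succ, mul_add]
    rw [ht, hm]
    split_ifs with h
    · have hp : 0 ≤ γ ^ t K := pow_nonneg hγ _
      -- The new term v is at most the new maximum, and the boundary term pays for it when its
      -- factor drops from γ^t to γ^(t+1).
      have hv := mul_le_mul_of_nonneg_left (le_max_right (m K) (v K))
        (mul_nonneg (by linarith : 0 ≤ 1 - γ) hp)
      rw [pow_succ]
      nlinarith
    · simpa using ih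

end Rounds

/-! ### The interaction with a single user -/

section Trajectory

variable {N : ℕ} (fb : FeedbackModel) (B : ℝ) (A : LearningAlgorithm N) (θ : Fin N → ℝ)
  (coin : ℕ → unitInterval) (ω : A.Seed)

/-- The user addressed and the action performed in step `k`. -/
def actionAt (k : ℕ) : Fin N × ℝ := A.choose ω (run fb B A θ coin ω k).history

/-- User `n` is present and addressed in step `k`. -/
def Addressed (n : Fin N) (k : ℕ) : Prop :=
  (actionAt fb B A θ coin ω k).1 = n ∧ (run fb B A θ coin ω k).Active B n

open Classical in
/-- The reward received from user `n` in step `k`. -/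
def userReward (r : ℝ → ℝ) (γ : ℝ) (n : Fin N) (k : ℕ) : ℝ :=
  if Addressed fb B A θ coin ω n k ∧ (actionAt fb B A θ coin ω k).2 ≤ θ n then
    γ ^ (run fb B A θ coin ω k).rounds n * r (actionAt fb B A θ coin ω k).2 else 0

open Classical in
/-- The discounted sum of `min (y, a)` over the first `K` steps, `y` ranging over the actions
performed on user `n`. -/
def exploration (a γ : ℝ) (n : Fin N) (K : ℕ) : ℝ :=
  ∑ k ∈ Finset.range K, if Addressed fb B A θ coin ω n k then
    γ ^ (run fb B A θ coin ω k).rounds n * min (actionAt fb B A θ coin ω k).2 a else 0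

open Classical in
/-- The maximum of `min (y, a)` over the actions `y` performed on user `n` before step `k`. -/
def reach (a : ℝ) (n : Fin N) : ℕ → ℝ
  | 0 => 0
  | k + 1 => if Addressed fb B A θ coin ω n k then
      max (reach a n k) (min (actionAt fb B A θ coin ω k).2 a) else reach a n k

open Classical in
/-- The discount factor of the first step before step `K` in which the action on user `n`
exceeds `x`. -/
def crossingDiscount (a γ : ℝ) (n : Fin N) (K : ℕ) (x : ℝ) : ℝ :=
  ∑ k ∈ Finset.range K, (Set.Ico (reach fb B A θ coin ω a n k)
    (reach fb B A θ coin ω a n (k + 1))).indicator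
      (fun _ => γ ^ (run fb B A θ coin ω k).rounds n) x

variable {fb B A θ coin ω}

/-! ### Rounds, reach and exploration along a trajectory -/

theorem actionAt_mem (k : ℕ) : (actionAt fb B A θ coin ω k).2 ∈ Set.Icc (0 : ℝ) 1 :=
  A.action_mem _ _

theorem stepReward_eq_sum (r : ℝ → ℝ) (γ : ℝ) (k : ℕ) :
    stepReward r γ fb B A θ coin ω k = ∑ n, userReward fb B A θ coin ω r γ n k := by
  rw [Finset.sum_eq_single (actionAt fb B A θ coin ω k).1]
  · classical
    unfold stepReward userReward
    refine if_congr ⟨fun h => ⟨⟨rfl, h.1⟩, h.2⟩, fun h => ⟨h.1.2, h.2⟩⟩ rfl rfl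
  · intro n _ hn
    rw [userReward, if_neg fun h => hn h.1.1.symm]
  · simp

open Classical in
theorem rounds_succ (n : Fin N) (k : ℕ) :
    (run fb B A θ coin ω (k + 1)).rounds n =
      if Addressed fb B A θ coin ω n k then (run fb B A θ coin ω k).rounds n + 1
      else (run fb B A θ coin ω k).rounds n := by
  have e : run fb B A θ coin ω (k + 1) = (run fb B A θ coin ω k).step fb B θ (coin k)
      (actionAt fb B A θ coin ω k) := rfl
  rw [e, PlatformState.step]
  by_cases hn : (actionAt fb B A θ coin ω k).1 = n
  · subst hn
    by_cases hact : (run fb B A θ coin ω k).Active B (actionAt fb B A θ coin ω k).1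
    · have hA : Addressed fb B A θ coin ω (actionAt fb B A θ coin ω k).1 k := ⟨rfl, hact⟩
      rw [if_pos hact, if_pos hA]
      split_ifs <;> simp
    · have hA : ¬ Addressed fb B A θ coin ω (actionAt fb B A θ coin ω k).1 k := fun h => hact h.2
      rw [if_neg hact, if_neg hA]
  · have hA : ¬ Addressed fb B A θ coin ω n k := fun h => hn h.1
    rw [if_neg hA]
    split_ifs <;> simp [Function.update_of_ne (Ne.symm hn)]

theorem reach_mono_succ (a : ℝ) (n : Fin N) (k : ℕ) :
    reach fb B A θ coin ω a n k ≤ reach fb B A θ coin ω a n (k + 1) := by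
  rw [reach]
  split_ifs
  · exact le_max_left _ _
  · exact le_rfl

theorem reach_mem {a : ℝ} (ha : 0 ≤ a) (n : Fin N) (k : ℕ) :
    0 ≤ reach fb B A θ coin ω a n k ∧ reach fb B A θ coin ω a n k ≤ a := by
  induction k with
  | zero => exact ⟨le_rfl, ha⟩
  | succ k ih =>
    rw [reach]
    split_ifs
    · exact ⟨ih.1.trans (le_max_left _ _), max_le ih.2 (min_le_right _ _)⟩
    · exact ih

theorem exploration_term_nonneg {a γ : ℝ} (ha : 0 ≤ a) (hγ : 0 ≤ γ) (n : Fin N) (k : ℕ) :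
    0 ≤ γ ^ (run fb B A θ coin ω k).rounds n * min (actionAt fb B A θ coin ω k).2 a :=
  mul_nonneg (pow_nonneg hγ _) (le_min (actionAt_mem k).1 ha)

theorem exploration_nonneg {a γ : ℝ} (ha : 0 ≤ a) (hγ : 0 ≤ γ) (n : Fin N) (K : ℕ) :
    0 ≤ exploration fb B A θ coin ω a γ n K :=
  Finset.sum_nonneg fun k _ => by
    split_ifs
    · exact exploration_term_nonneg ha hγ n k
    · exact le_rfl

theorem exploration_le {a γ : ℝ} (ha : 0 ≤ a) (hγ : 0 ≤ γ) (hγ1 : γ < 1) (n : Fin N) (K : ℕ) :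
    exploration fb B A θ coin ω a γ n K ≤ a / (1 - γ) := by
  classical
  have h := sum_discount_rounds (act := Addressed fb B A θ coin ω n)
    (t := fun k => (run fb B A θ coin ω k).rounds n) (γ := γ) hγ1 rfl (rounds_succ n) K
  have h1 : 0 < 1 - γ := by linarith
  calc exploration fb B A θ coin ω a γ n K
      ≤ ∑ k ∈ Finset.range K, (if Addressed fb B A θ coin ω n k then
          γ ^ (run fb B A θ coin ω k).rounds n else 0) * a := by
        refine Finset.sum_le_sum fun k _ => ?_
        split_ifs
        · exact mul_le_mul_of_nonneg_left (min_le_right _ _) (pow_nonneg hγ _)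
        · simp
    _ = (1 - γ ^ (run fb B A θ coin ω K).rounds n) / (1 - γ) * a := by
        rw [← Finset.sum_mul, h]
    _ ≤ 1 / (1 - γ) * a := by
        have := pow_nonneg hγ ((run fb B A θ coin ω K).rounds n)
        gcongr
        linarith
    _ = a / (1 - γ) := by ring

theorem userReward_nonneg {r : ℝ → ℝ} {γ : ℝ} (hr : ∀ y ∈ Set.Icc (0 : ℝ) 1, 0 ≤ r y)
    (hγ : 0 ≤ γ) (n : Fin N) (k : ℕ) : 0 ≤ userReward fb B A θ coin ω r γ n k := by
  rw [userReward]
  split_ifs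
  · exact mul_nonneg (pow_nonneg hγ _) (hr _ (actionAt_mem k))
  · exact le_rfl

/-- The base rewards form a geometric series. Everything above them is at most η times the
exploration, which counts actions whether or not they succeed. -/
theorem sum_userReward_le {R η a γ : ℝ} (hR : 0 ≤ R) (hη : 0 ≤ η) (ha : 0 ≤ a) (hγ : 0 ≤ γ)
    (hγ1 : γ < 1) (n : Fin N) (K : ℕ) :
    ∑ k ∈ Finset.range K, userReward fb B A θ coin ω (capReward R η a) γ n k ≤
      R / (1 - γ) + η * exploration fb B A θ coin ω a γ n K := by
  classical
  have h := sum_discount_rounds (act := Addressed fb B A θ coin ω n)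
    (t := fun k => (run fb B A θ coin ω k).rounds n) (γ := γ) hγ1 rfl (rounds_succ n) K
  have h1 : 0 < 1 - γ := by linarith
  calc ∑ k ∈ Finset.range K, userReward fb B A θ coin ω (capReward R η a) γ n k
      ≤ ∑ k ∈ Finset.range K, (R * (if Addressed fb B A θ coin ω n k then
          γ ^ (run fb B A θ coin ω k).rounds n else 0) +
          η * (if Addressed fb B A θ coin ω n k then γ ^ (run fb B A θ coin ω k).rounds n *
            min (actionAt fb B A θ coin ω k).2 a else 0)) := by
        refine Finset.sum_le_sum fun k _ => ?_
        rw [userReward]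
        by_cases hA : Addressed fb B A θ coin ω n k
        · have e := exploration_term_nonneg (fb := fb) (B := B) (A := A) (θ := θ) (coin := coin)
            (ω := ω) ha hγ n k
          have e2 := pow_nonneg hγ ((run fb B A θ coin ω k).rounds n)
          simp only [hA, true_and, if_true]
          split_ifs
          · rw [capReward]
            exact le_of_eq (by ring)
          · positivity
        · simp [hA]
    _ = R * ((1 - γ ^ (run fb B A θ coin ω K).rounds n) / (1 - γ)) +
          η * exploration fb B A θ coin ω a γ n K := by
        rw [Finset.sum_add_distrib, ← Finset.mul_sum, ← Finset.mul_sum, h, exploration]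
    _ ≤ R / (1 - γ) + η * exploration fb B A θ coin ω a γ n K := by
        have := pow_nonneg hγ ((run fb B A θ coin ω K).rounds n)
        rw [mul_div_assoc']
        gcongr
        nlinarith

theorem step_congr {s : PlatformState N} {θ' : Fin N → ℝ} {c : ℝ} {act : Fin N × ℝ}
    (h : s.Active B act.1 → (act.2 ≤ θ act.1 ↔ act.2 ≤ θ' act.1)) :
    s.step fb B θ c act = s.step fb B θ' c act := by
  unfold PlatformState.step
  by_cases hs : s.Active B act.1
  · simp only [if_pos hs, h hs]
  · simp only [if_neg hs]

/-- Lowering the threshold of one user below `a` has no effect before it is crossed. -/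
theorem run_update_eq {a x : ℝ} {n : Fin N} (hn : a ≤ θ n) (hx : x < a) (k : ℕ)
    (hk : reach fb B A θ coin ω a n k ≤ x) :
    run fb B A (Function.update θ n x) coin ω k = run fb B A θ coin ω k := by
  induction k with
  | zero => rfl
  | succ k ih =>
    have ih := ih ((reach_mono_succ a n k).trans hk)
    simp only [run]
    rw [ih]
    refine step_congr fun hs => ?_
    by_cases hm : (A.choose ω (run fb B A θ coin ω k).history).1 = n
    · have hA : Addressed fb B A θ coin ω n k := ⟨hm, hm ▸ hs⟩
      rw [reach, if_pos hA] at hk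
      have h2 : min (actionAt fb B A θ coin ω k).2 a ≤ x := (le_max_right _ _).trans hk
      have h3 : (actionAt fb B A θ coin ω k).2 ≤ x := by
        rcases min_le_iff.1 h2 with h | h
        · exact h
        · linarith
      rw [hm, Function.update_self]
      exact ⟨fun _ => h3.trans (hx.le.trans hn), fun _ => h3⟩
    · rw [Function.update_of_ne hm]

open Classical in
/-- If the threshold of user `n` is lowered to `x < a`, then the reward from this user is at most
what the original run suggests, minus the loss from the first crossing. -/
theorem sum_userReward_update_le {R η a γ x : ℝ} (hR : 0 ≤ R) (hη : 0 ≤ η) (ha : 0 ≤ a)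
    (hγ : 0 ≤ γ) (hγ1 : γ < 1) (hRa : 2 * (η * a / (1 - γ)) ≤ R) {n : Fin N} (hn : a ≤ θ n)
    (hx0 : 0 ≤ x) (hx : x < a) (K : ℕ) :
    ∑ k ∈ Finset.range K,
        userReward fb B A (Function.update θ n x) coin ω (capReward R η a) γ n k ≤
      R / (1 - γ) + η * exploration fb B A θ coin ω a γ n K -
        R / 2 * crossingDiscount fb B A θ coin ω a γ n K x := by
  have h1 : 0 < 1 - γ := by linarith
  set θ' := Function.update θ n x with hθ'
  have hθn : θ' n = x := Function.update_self _ _ _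
  set P : ℕ → ℝ := fun K =>
    ∑ k ∈ Finset.range K, userReward fb B A θ' coin ω (capReward R η a) γ n k with hP
  set Z : ℕ → ℝ := fun K => exploration fb B A θ coin ω a γ n K with hZ
  set W : ℕ → ℝ := fun K => crossingDiscount fb B A θ coin ω a γ n K x with hW
  set M : ℕ → ℝ := fun K => reach fb B A θ coin ω a n K with hM
  set t : ℕ → ℕ := fun K => (run fb B A θ' coin ω K).rounds n with ht
  have hPs : ∀ K, P (K + 1) = P K + userReward fb B A θ' coin ω (capReward R η a) γ n K :=
    fun K => Finset.sum_range_succ _ _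
  have hZs : ∀ K, Z (K + 1) = Z K + if Addressed fb B A θ coin ω n K then
      γ ^ (run fb B A θ coin ω K).rounds n * min (actionAt fb B A θ coin ω K).2 a else 0 :=
    fun K => Finset.sum_range_succ _ _
  have hWs : ∀ K, W (K + 1) = W K + (Set.Ico (M K) (M (K + 1))).indicator
      (fun _ => γ ^ (run fb B A θ coin ω K).rounds n) x :=
    fun K => Finset.sum_range_succ _ _
  have hMs : ∀ K, M (K + 1) = if Addressed fb B A θ coin ω n K then
      max (M K) (min (actionAt fb B A θ coin ω K).2 a) else M K := fun K => rfl
  have hts : ∀ K, t (K + 1) = if Addressed fb B A θ' coin ω n K then t K + 1 else t K :=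
    fun K => rounds_succ n K
  have hc : ∀ k : ℕ, γ ^ (k + 1) * (R / (1 - γ) + η * a / (1 - γ)) =
      γ ^ k * (R / (1 - γ) + η * a / (1 - γ)) - γ ^ k * (R + η * a) := fun k => by
    rw [pow_succ]
    field_simp
    ring
  have hc' : ∀ k : ℕ, γ ^ (k + 1) * (R / (1 - γ)) = γ ^ k * (R / (1 - γ)) - γ ^ k * R :=
    fun k => by
      rw [pow_succ]
      field_simp
      ring
  -- Before the crossing the lowered and the original run agree, and γ^t R/(1-γ) is the base reward
  -- still to come. After it, γ^t (R + ηa)/(1-γ) bounds all that the lowered run can still earn; `t`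
  -- counts the rounds of the lowered run.
  have inv : ∀ K, (M K ≤ x ∧ P K ≤ R / (1 - γ) - γ ^ t K * (R / (1 - γ)) + η * Z K ∧ W K = 0) ∨
      (x < M K ∧ P K + γ ^ t K * (R / (1 - γ) + η * a / (1 - γ)) ≤
        R / (1 - γ) + η * Z K - R / 2 * W K) := by
    intro K
    induction K with
    | zero =>
      left
      refine ⟨hx0, ?_, ?_⟩
      · simp [hP, hZ, ht, exploration, run]
      · simp [hW, crossingDiscount]
    | succ K ih =>
      have hpow : 0 ≤ γ ^ t K := pow_nonneg hγ _
      rcases ih with ⟨i1, i2, i3⟩ | ⟨i1, i2⟩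
      · have hrun : run fb B A θ' coin ω K = run fb B A θ coin ω K := run_update_eq hn hx K i1
        have hact : actionAt fb B A θ' coin ω K = actionAt fb B A θ coin ω K := by
          simp only [actionAt, hrun]
        have hadd : Addressed fb B A θ' coin ω n K ↔ Addressed fb B A θ coin ω n K := by
          simp only [Addressed, hrun, hact]
        have htr : t K = (run fb B A θ coin ω K).rounds n := by simp only [ht, hrun]
        by_cases hA : Addressed fb B A θ coin ω n K
        · have hA' := hadd.2 hA
          have t1 := hts K
          have m1 := hMs K
          have z1 := hZs K
          rw [if_pos hA'] at t1
          rw [if_pos hA] at m1 z1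
          have p1 := hPs K
          have w1 := hWs K
          rw [userReward, hθn] at p1
          simp only [hA', true_and, hact, hrun] at p1
          rw [← htr] at p1 z1 w1
          by_cases hr : M (K + 1) ≤ x
          · left
            have h2 : min (actionAt fb B A θ coin ω K).2 a ≤ x :=
              (le_max_right _ _).trans (m1 ▸ hr)
            have h3 : (actionAt fb B A θ coin ω K).2 ≤ x := by
              rcases min_le_iff.1 h2 with h | h
              · exact h
              · linarith
            rw [if_pos h3, capReward] at p1
            rw [Set.indicator_of_notMem (fun h => absurd hr (not_le.2 h.2))] at w1
            refine ⟨hr, ?_, by linarith⟩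
            rw [p1, t1, z1, hc']
            linarith
          · right
            push Not at hr
            have h2 : x < min (actionAt fb B A θ coin ω K).2 a := by
              rw [m1] at hr
              rcases lt_max_iff.1 hr with h | h
              · linarith
              · exact h
            have h3 : ¬ (actionAt fb B A θ coin ω K).2 ≤ x := not_le.2 (lt_min_iff.1 h2).1
            rw [if_neg h3] at p1
            rw [Set.indicator_of_mem (show x ∈ Set.Ico (M K) (M (K + 1)) from ⟨i1, hr⟩)] at w1
            refine ⟨hr, ?_⟩
            rw [p1, t1, z1, w1, i3, hc]
            have e1 : 0 ≤ γ ^ t K * min (actionAt fb B A θ coin ω K).2 a :=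
              mul_nonneg hpow (hx0.trans h2.le)
            have e2 := mul_nonneg hη e1
            -- The failed round forfeits γ^t (R + ηa), while passing to the cruder bound for the
            -- future costs γ^t ηa/(1-γ) ≤ γ^t R/2. The net loss is at least γ^t R/2.
            have e3 := mul_le_mul_of_nonneg_left hRa hpow
            have e4 : 0 ≤ γ ^ t K * (η * a) := mul_nonneg hpow (mul_nonneg hη ha)
            linarith
        · have hA' := fun h => hA (hadd.1 h)
          left
          have t1 := hts K
          have m1 := hMs K
          have z1 := hZs K
          rw [if_neg hA'] at t1
          rw [if_neg hA] at m1 z1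
          have p1 := hPs K
          have w1 := hWs K
          rw [userReward, if_neg fun h => hA' h.1] at p1
          rw [m1, Set.Ico_self, Set.indicator_empty] at w1
          rw [m1, p1, t1, z1, w1]
          exact ⟨i1, by linarith, by linarith⟩
      · right
        have hmono : M K ≤ M (K + 1) := reach_mono_succ a n K
        have w1 := hWs K
        -- The reach has already passed `x`, so the loss is charged only once.
        rw [Set.indicator_of_notMem (fun h => absurd h.1 (not_le.2 i1))] at w1
        have z1 : Z K ≤ Z (K + 1) := by
          rw [hZs]
          have : 0 ≤ if Addressed fb B A θ coin ω n K then γ ^ (run fb B A θ coin ω K).rounds n *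
              min (actionAt fb B A θ coin ω K).2 a else 0 := by
            split_ifs
            · exact exploration_term_nonneg ha hγ n K
            · exact le_rfl
          linarith
        have z2 := mul_le_mul_of_nonneg_left z1 hη
        refine ⟨i1.trans_le hmono, ?_⟩
        have t1 := hts K
        have p1 := hPs K
        rw [userReward] at p1
        by_cases hA' : Addressed fb B A θ' coin ω n K
        · rw [if_pos hA'] at t1
          have p2 : P (K + 1) ≤ P K + γ ^ t K * (R + η * a) := by
            rw [p1]
            split_ifs
            · have := mul_le_mul_of_nonneg_left
                (capReward_le (R := R) (a := a) hη (actionAt fb B A θ' coin ω K).2) hpow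
              linarith
            · have : 0 ≤ γ ^ t K * (R + η * a) := by positivity
              linarith
          rw [t1, hc, w1]
          linarith
        · rw [if_neg fun h => hA' h.1] at p1
          rw [if_neg hA'] at t1
          rw [t1, w1, p1]
          linarith
  rcases inv K with ⟨-, i2, i3⟩ | ⟨-, i2⟩
  · change P K ≤ R / (1 - γ) + η * Z K - R / 2 * W K
    have : 0 ≤ γ ^ t K * (R / (1 - γ)) := by positivity
    rw [i3]
    linarith
  · change P K ≤ R / (1 - γ) + η * Z K - R / 2 * W K
    have : 0 ≤ γ ^ t K * (R / (1 - γ) + η * a / (1 - γ)) := by positivity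
    linarith

/-! ### Averaging the first crossing over a uniform threshold -/

theorem lowLaw_real_Ico {a c d : ℝ} (ha : 0 < a) (hc : 0 ≤ c) (hcd : c ≤ d) (hd : d ≤ a) :
    (lowLaw a).real (Set.Ico c d) = (d - c) / a := by
  have h : volume (Set.Ico c d ∩ Set.Ioo 0 a) = ENNReal.ofReal (d - c) := by
    refine le_antisymm ?_ ?_
    · rw [← Real.volume_Ico]
      exact measure_mono Set.inter_subset_left
    · rw [← Real.volume_Ioo]
      exact measure_mono fun x hx => ⟨⟨hx.1.le, hx.2⟩, hc.trans_lt hx.1, hx.2.trans_le hd⟩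
  simp only [measureReal_def, lowLaw, Measure.smul_apply, smul_eq_mul,
    Measure.restrict_apply measurableSet_Ico, h]
  rw [← ENNReal.ofReal_mul (by positivity), ENNReal.toReal_ofReal
    (mul_nonneg (by positivity) (by linarith))]
  ring

theorem integrable_crossingDiscount {a γ : ℝ} (ha : 0 < a) (n : Fin N) (K : ℕ) :
    Integrable (crossingDiscount fb B A θ coin ω a γ n K) (lowLaw a) := by
  have := isProbabilityMeasure_lowLaw ha
  unfold crossingDiscount
  exact integrable_finsetSum _ fun k _ => (integrable_const _).indicator measurableSet_Ico

/-- A uniform threshold falls into an increment of the reach with probability its length over `a`.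
Summation by parts then compares the discounted increments of this running maximum with the
discounted sum of the capped actions. -/
theorem integral_crossingDiscount_ge {a γ : ℝ} (ha : 0 < a) (hγ : 0 ≤ γ) (hγ1 : γ < 1)
    (n : Fin N) (K : ℕ) :
    (1 - γ) / a * exploration fb B A θ coin ω a γ n K ≤
      ∫ x, crossingDiscount fb B A θ coin ω a γ n K x ∂lowLaw a := by
  classical
  have := isProbabilityMeasure_lowLaw ha
  unfold crossingDiscount
  rw [integral_finsetSum _ fun k _ => (integrable_const _).indicator measurableSet_Ico]
  have e : ∀ k ∈ Finset.range K, ∫ x, (Set.Ico (reach fb B A θ coin ω a n k)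
      (reach fb B A θ coin ω a n (k + 1))).indicator
      (fun _ => γ ^ (run fb B A θ coin ω k).rounds n) x ∂lowLaw a =
      γ ^ (run fb B A θ coin ω k).rounds n *
        (reach fb B A θ coin ω a n (k + 1) - reach fb B A θ coin ω a n k) / a := by
    intro k _
    rw [integral_indicator_const _ measurableSet_Ico, lowLaw_real_Ico ha (reach_mem ha.le n k).1
      (reach_mono_succ a n k) (reach_mem ha.le n (k + 1)).2, smul_eq_mul]
    ring
  rw [Finset.sum_congr rfl e, ← Finset.sum_div, div_mul_eq_mul_div]
  have h := discounted_sum_le_sum_increments (γ := γ) hγ hγ1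
    (act := Addressed fb B A θ coin ω n) (t := fun k => (run fb B A θ coin ω k).rounds n)
    (v := fun k => min (actionAt fb B A θ coin ω k).2 a)
    (m := reach fb B A θ coin ω a n) (rounds_succ n) rfl (fun k => rfl) K
  have h2 : 0 ≤ γ ^ (run fb B A θ coin ω K).rounds n * reach fb B A θ coin ω a n K :=
    mul_nonneg (pow_nonneg hγ _) (reach_mem ha.le n K).1
  gcongr
  rw [exploration]
  linarith

end Trajectory

/-! ### Measurability of the interaction -/

/-- The interaction state takes countably many values, so measurability only has to be checked with
the state frozen. -/
theorem measurable_comp_countable {X S Y : Type*} [MeasurableSpace X] [MeasurableSpace S]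
    [MeasurableSpace Y] [Countable S] [MeasurableSingletonClass S] {s : X → S}
    (hs : Measurable s) {g : S → X → Y} (hg : ∀ c, Measurable (g c)) :
    Measurable fun x => g (s x) x :=
  (measurable_from_prod_countable_right (f := fun p : S × X => g p.1 p.2) hg).comp
    (hs.prodMk measurable_id)

instance : Countable Observation :=
  Function.Injective.countable (f := fun o : Observation => (o.feedback, o.abandoned))
    fun ⟨_, _⟩ ⟨_, _⟩ h => by simpa using h

instance (N : ℕ) : Countable (PlatformState N) :=
  Function.Injective.countable
    (f := fun s : PlatformState N => (s.history, s.rounds, s.crossings))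
    fun ⟨_, _, _⟩ ⟨_, _, _⟩ h => by simpa using h

instance (N : ℕ) : MeasurableSpace (PlatformState N) := ⊤

instance (N : ℕ) : DiscreteMeasurableSpace (PlatformState N) := ⟨fun _ => trivial⟩

section Measurability

variable {N : ℕ} (fb : FeedbackModel) (B : ℝ) (A : LearningAlgorithm N)

theorem measurable_step (s : PlatformState N) (m : Fin N) (k : ℕ) :
    Measurable fun x : (Fin N → ℝ) × (ℕ → unitInterval) × A.Seed =>
      s.step fb B x.1 (x.2.1 k) (m, (A.choose x.2.2 s.history).2) := by
  let _ : MeasurableSpace (Option Bool) := ⊤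
  have : DiscreteMeasurableSpace (Option Bool) := ⟨fun _ => trivial⟩
  have hy : Measurable fun x : (Fin N → ℝ) × (ℕ → unitInterval) × A.Seed =>
      (A.choose x.2.2 s.history).2 :=
    (A.measurable_choose s.history).snd.comp measurable_snd.snd
  have hθ : Measurable fun x : (Fin N → ℝ) × (ℕ → unitInterval) × A.Seed => x.1 m :=
    (measurable_pi_apply m).comp measurable_fst
  have hc : Measurable fun x : (Fin N → ℝ) × (ℕ → unitInterval) × A.Seed =>
      ((x.2.1 k : unitInterval) : ℝ) :=
    measurable_subtype_coe.comp ((measurable_pi_apply k).comp measurable_snd.fst)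
  have h1 := measurableSet_le hy hθ
  have h2 : MeasurableSet {x : (Fin N → ℝ) × (ℕ → unitInterval) × A.Seed |
      ((x.2.1 k : unitInterval) : ℝ) ≤ fb.p₁} := measurableSet_le hc measurable_const
  have h3 : MeasurableSet {x : (Fin N → ℝ) × (ℕ → unitInterval) × A.Seed |
      ((x.2.1 k : unitInterval) : ℝ) ≤ fb.p₂} := measurableSet_le hc measurable_const
  have hobs : ∀ (v : Bool) (p : ℝ), MeasurableSet {x : (Fin N → ℝ) × (ℕ → unitInterval) × A.Seed |
      ((x.2.1 k : unitInterval) : ℝ) ≤ p} →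
      Measurable fun x : (Fin N → ℝ) × (ℕ → unitInterval) × A.Seed =>
        (if ((x.2.1 k : unitInterval) : ℝ) ≤ p then some v else none : Option Bool) :=
    fun v p h => Measurable.ite h measurable_const measurable_const
  classical
  unfold PlatformState.step
  by_cases hs : s.Active B m
  · simp only [if_pos hs]
    refine Measurable.ite h1 ?_ ?_
    · exact (measurable_of_countable fun o : Option Bool => (⟨⟨o, false⟩ :: s.history,
        Function.update s.rounds m (s.rounds m + 1), s.crossings⟩ : PlatformState N)).comp
        (hobs true _ h2)
    · exact (measurable_of_countable fun o : Option Bool => (⟨⟨o,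
        decide (B - ((s.crossings m : ℝ) + 1) ≤ 0)⟩ :: s.history,
        Function.update s.rounds m (s.rounds m + 1),
        Function.update s.crossings m (s.crossings m + 1)⟩ : PlatformState N)).comp
        (hobs false _ h3)
  · simp only [if_neg hs]
    exact measurable_const

theorem measurable_run (k : ℕ) :
    Measurable fun x : (Fin N → ℝ) × (ℕ → unitInterval) × A.Seed =>
      run fb B A x.1 x.2.1 x.2.2 k := by
  induction k with
  | zero => exact measurable_const
  | succ k ih =>
    have hm : Measurable fun x : (Fin N → ℝ) × (ℕ → unitInterval) × A.Seed =>
        (A.choose x.2.2 (run fb B A x.1 x.2.1 x.2.2 k).history).1 :=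
      measurable_comp_countable (g := fun s x => (A.choose x.2.2 s.history).1) ih fun s =>
        (A.measurable_choose s.history).fst.comp measurable_snd.snd
    exact measurable_comp_countable
      (g := fun (p : PlatformState N × Fin N)
        (x : (Fin N → ℝ) × (ℕ → unitInterval) × A.Seed) =>
          p.1.step fb B x.1 (x.2.1 k) (p.2, (A.choose x.2.2 p.1.history).2))
      (ih.prodMk hm) fun p => measurable_step fb B A p.1 p.2 k

theorem measurable_action_of_history (s : PlatformState N) :
    Measurable fun x : (Fin N → ℝ) × (ℕ → unitInterval) × A.Seed =>
      (A.choose x.2.2 s.history).2 :=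
  (A.measurable_choose s.history).snd.comp measurable_snd.snd

theorem measurableSet_addressed_of_state (s : PlatformState N) (n : Fin N) :
    MeasurableSet {x : (Fin N → ℝ) × (ℕ → unitInterval) × A.Seed |
      (A.choose x.2.2 s.history).1 = n ∧ s.Active B n} :=
  (((A.measurable_choose s.history).fst.comp measurable_snd.snd)
    (measurableSet_singleton n)).inter (MeasurableSet.const _)

theorem measurable_userReward {r : ℝ → ℝ} (hr : Measurable r) (γ : ℝ) (n : Fin N) (k : ℕ) :
    Measurable fun x : (Fin N → ℝ) × (ℕ → unitInterval) × A.Seed =>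
      userReward fb B A x.1 x.2.1 x.2.2 r γ n k := by
  classical
  have h := measurable_comp_countable (g := fun (s : PlatformState N)
    (x : (Fin N → ℝ) × (ℕ → unitInterval) × A.Seed) =>
      if ((A.choose x.2.2 s.history).1 = n ∧ s.Active B n) ∧ (A.choose x.2.2 s.history).2 ≤ x.1 n
      then γ ^ s.rounds n * r (A.choose x.2.2 s.history).2 else 0)
    (measurable_run fb B A k) fun s => Measurable.ite ((measurableSet_addressed_of_state B A s n).inter
    (measurableSet_le (measurable_action_of_history A s)
      ((measurable_pi_apply n).comp measurable_fst)))
      ((hr.comp (measurable_action_of_history A s)).const_mul _) measurable_const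
  refine Eq.mp (congrArg Measurable (funext fun x => ?_)) h
  by_cases hx : Addressed fb B A x.1 x.2.1 x.2.2 n k ∧ (actionAt fb B A x.1 x.2.1 x.2.2 k).2 ≤ x.1 n
  · exact (if_pos hx).trans (if_pos hx).symm
  · exact (if_neg hx).trans (if_neg hx).symm

theorem measurable_exploration (a γ : ℝ) (n : Fin N) (K : ℕ) :
    Measurable fun x : (Fin N → ℝ) × (ℕ → unitInterval) × A.Seed =>
      exploration fb B A x.1 x.2.1 x.2.2 a γ n K := by
  classical
  unfold exploration
  refine Finset.measurable_sum _ fun k _ => ?_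
  have h := measurable_comp_countable (g := fun (s : PlatformState N)
    (x : (Fin N → ℝ) × (ℕ → unitInterval) × A.Seed) =>
      if (A.choose x.2.2 s.history).1 = n ∧ s.Active B n
      then γ ^ s.rounds n * min (A.choose x.2.2 s.history).2 a else 0)
    (measurable_run fb B A k) fun s => Measurable.ite (measurableSet_addressed_of_state B A s n)
      (((measurable_action_of_history A s).min measurable_const).const_mul _) measurable_const
  refine Eq.mp (congrArg Measurable (funext fun x => ?_)) h
  by_cases hx : Addressed fb B A x.1 x.2.1 x.2.2 n k
  · exact (if_pos hx).trans (if_pos hx).symm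
  · exact (if_neg hx).trans (if_neg hx).symm

theorem measurable_capReward (R η a : ℝ) : Measurable (capReward R η a) :=
  measurable_const.add ((measurable_id.min measurable_const).const_mul _)

end Measurability

/-! ### Expected rewards under different threshold laws -/

theorem measurePreserving_update {ι : Type*} [Fintype ι] [DecidableEq ι] (μ : Measure ℝ)
    [IsProbabilityMeasure μ] (n : ι) :
    MeasurePreserving (fun p : (ι → ℝ) × ℝ => Function.update p.1 n p.2)
      ((Measure.pi fun _ => μ).prod μ) (Measure.pi fun _ => μ) := by
  refine ⟨measurable_update', (Measure.pi_eq fun s hs => ?_).symm⟩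
  rw [Measure.map_apply measurable_update' (MeasurableSet.univ_pi hs)]
  have e : (fun p : (ι → ℝ) × ℝ => Function.update p.1 n p.2) ⁻¹' Set.univ.pi s =
      (Set.univ.pi (Function.update s n Set.univ)) ×ˢ s n := by
    ext p
    simp only [Set.mem_preimage, Set.mem_univ_pi, Set.mem_prod]
    constructor
    · intro h
      refine ⟨fun i => ?_, by simpa using h n⟩
      by_cases hi : i = n
      · subst hi
        simp
      · simpa [Function.update_of_ne hi] using h i
    · rintro ⟨h1, h2⟩ i
      by_cases hi : i = n
      · subst hi
        simpa using h2
      · simpa [Function.update_of_ne hi] using h1 i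
  rw [e, Measure.prod_prod, Measure.pi_pi, ← Finset.mul_prod_erase _ _ (Finset.mem_univ n),
    ← Finset.mul_prod_erase (Finset.univ : Finset ι) (fun i => μ (s i)) (Finset.mem_univ n)]
  have h2 : ∏ i ∈ Finset.univ.erase n, μ (Function.update s n Set.univ i) =
      ∏ i ∈ Finset.univ.erase n, μ (s i) :=
    Finset.prod_congr rfl fun i hi => by rw [Function.update_of_ne (Finset.ne_of_mem_erase hi)]
  rw [h2, Function.update_self, measure_univ, one_mul, mul_comm]

/-! ### Integration against the threshold laws -/

theorem integrable_of_mem_Icc {X : Type*} [MeasurableSpace X] {μ : Measure X} [IsFiniteMeasure μ]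
    {g : X → ℝ} (hg : Measurable g) {C : ℝ} (hC : ∀ x, g x ∈ Set.Icc 0 C) : Integrable g μ :=
  Integrable.of_bound hg.aestronglyMeasurable C (Filter.Eventually.of_forall fun x => by
    rw [Real.norm_of_nonneg (hC x).1]
    exact (hC x).2)

/-- Fubini after resampling: one user's threshold is averaged first, with the other thresholds fixed
and the old value discarded. -/
theorem integral_update {ι : Type*} [Fintype ι] [DecidableEq ι] (μ : Measure ℝ)
    [IsProbabilityMeasure μ] (n : ι) {g : (ι → ℝ) → ℝ} (hg : Measurable g) {C : ℝ}
    (hC : ∀ x, g x ∈ Set.Icc 0 C) :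
    ∫ θ, g θ ∂Measure.pi (fun _ => μ) =
      ∫ θ, ∫ x, g (Function.update θ n x) ∂μ ∂Measure.pi (fun _ => μ) := by
  have h := measurePreserving_update μ n
  rw [← h.map_eq, integral_map h.measurable.aemeasurable hg.aestronglyMeasurable, h.map_eq]
  exact integral_prod _ (integrable_of_mem_Icc (hg.comp h.measurable) fun x => hC _)

theorem integral_mixedLaw {a ε : ℝ} (ha : 0 < a) (ha1 : a < 1) (hε : 0 ≤ ε) (hε1 : ε ≤ 1)
    {g : ℝ → ℝ} (hg : Measurable g) {C : ℝ} (hC : ∀ x, g x ∈ Set.Icc 0 C) :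
    ∫ x, g x ∂mixedLaw a ε = (1 - ε) * ∫ x, g x ∂highLaw a + ε * ∫ x, g x ∂lowLaw a := by
  have := isProbabilityMeasure_lowLaw ha
  have := isProbabilityMeasure_highLaw ha1
  rw [mixedLaw, integral_add_measure, integral_smul_measure, integral_smul_measure,
    ENNReal.toReal_ofReal (by linarith), ENNReal.toReal_ofReal hε, smul_eq_mul, smul_eq_mul]
  · exact (integrable_of_mem_Icc hg hC).smul_measure ENNReal.ofReal_ne_top
  · exact (integrable_of_mem_Icc hg hC).smul_measure ENNReal.ofReal_ne_top

theorem integral_pi_highLaw_le {N : ℕ} {a ε : ℝ} (ha : 0 < a) (ha1 : a < 1) (hε : 0 ≤ ε)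
    (hε1 : ε ≤ 1) {g : (Fin N → ℝ) → ℝ} (hg : Measurable g) {C : ℝ}
    (hC : ∀ x, g x ∈ Set.Icc 0 C) :
    (1 - ε) ^ N * ∫ θ, g θ ∂Measure.pi (fun _ => highLaw a) ≤
      ∫ θ, g θ ∂Measure.pi (fun _ => mixedLaw a ε) := by
  have := isProbabilityMeasure_mixedLaw ha ha1 hε hε1
  have h := integral_mono_measure (smul_pi_highLaw_le (N := N) ha ha1 hε hε1)
    (Filter.Eventually.of_forall fun x => (hC x).1) (integrable_of_mem_Icc hg hC)
  rwa [integral_smul_measure, ENNReal.toReal_ofReal (pow_nonneg (by linarith) _),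
    smul_eq_mul] at h

theorem ae_highLaw {a : ℝ} : ∀ᵐ x ∂highLaw a, a ≤ x := by
  have h : ∀ᵐ x ∂(volume.restrict (Set.Ico a 1)), a ≤ x := by
    filter_upwards [ae_restrict_mem measurableSet_Ico] with x hx using hx.1
  exact Measure.ae_smul_measure h _

theorem ae_lowLaw {a : ℝ} : ∀ᵐ x ∂lowLaw a, 0 < x ∧ x < a := by
  have h : ∀ᵐ x ∂(volume.restrict (Set.Ioo 0 a)), 0 < x ∧ x < a := by
    filter_upwards [ae_restrict_mem measurableSet_Ioo] with x hx using hx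
  exact Measure.ae_smul_measure h _

section Expectation

variable {N : ℕ} (fb : FeedbackModel) (B : ℝ) (A : LearningAlgorithm N)

/-- The reward received from user `n` in the first `K` steps. -/
def totalUserReward (r : ℝ → ℝ) (γ : ℝ) (n : Fin N) (K : ℕ)
    (x : (Fin N → ℝ) × (ℕ → unitInterval) × A.Seed) : ℝ :=
  ∑ k ∈ Finset.range K, userReward fb B A x.1 x.2.1 x.2.2 r γ n k

/-- The law of thresholds, coins and seed when the thresholds have law `μ`. -/
def interactionLaw (μ : Measure ℝ) : Measure ((Fin N → ℝ) × (ℕ → unitInterval) × A.Seed) :=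
  (Measure.pi fun _ => μ).prod
    ((Measure.infinitePi fun _ => (volume : Measure unitInterval)).prod A.law)

instance : IsProbabilityMeasure A.law := A.isProbabilityMeasure_law

instance (μ : Measure ℝ) [IsProbabilityMeasure μ] : IsProbabilityMeasure (interactionLaw A μ) := by
  unfold interactionLaw
  infer_instance

theorem measurable_totalUserReward {r : ℝ → ℝ} (hr : Measurable r) (γ : ℝ) (n : Fin N) (K : ℕ) :
    Measurable (totalUserReward fb B A r γ n K) :=
  Finset.measurable_sum _ fun k _ => measurable_userReward fb B A hr γ n k

variable {R η a γ : ℝ}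

theorem totalUserReward_mem (hR : 0 ≤ R) (hη : 0 ≤ η) (ha : 0 ≤ a) (hγ : 0 ≤ γ)
    (hγ1 : γ < 1) (n : Fin N) (K : ℕ) (x : (Fin N → ℝ) × (ℕ → unitInterval) × A.Seed) :
    totalUserReward fb B A (capReward R η a) γ n K x ∈
      Set.Icc 0 (R / (1 - γ) + η * (a / (1 - γ))) := by
  refine ⟨Finset.sum_nonneg fun k _ => userReward_nonneg (capReward_nonneg hR hη ha) hγ n k,
    (sum_userReward_le hR hη ha hγ hγ1 n K).trans ?_⟩
  have := mul_le_mul_of_nonneg_left (exploration_le (fb := fb) (B := B) (A := A) (θ := x.1)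
    (coin := x.2.1) (ω := x.2.2) ha hγ hγ1 n K) hη
  linarith

theorem exploration_mem (ha : 0 ≤ a) (hγ : 0 ≤ γ) (hγ1 : γ < 1) (n : Fin N) (K : ℕ)
    (x : (Fin N → ℝ) × (ℕ → unitInterval) × A.Seed) :
    exploration fb B A x.1 x.2.1 x.2.2 a γ n K ∈ Set.Icc 0 (a / (1 - γ)) :=
  ⟨exploration_nonneg ha hγ n K, exploration_le ha hγ hγ1 n K⟩

/-- Exploration does not pay on average if low thresholds are likely enough. -/
theorem integral_totalUserReward_thresholds_le (hR : 0 ≤ R) (hη : 0 ≤ η) (ha : 0 < a)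
    (ha1 : a < 1) (hγ : 0 ≤ γ) (hγ1 : γ < 1) (hRa : 2 * (η * a / (1 - γ)) ≤ R) {ε : ℝ}
    (hε : 0 ≤ ε) (hε1 : ε ≤ 1) (hεR : 4 * η ≤ ε * (R / 2 * ((1 - γ) / a))) (n : Fin N) (K : ℕ)
    (c : (ℕ → unitInterval) × A.Seed) :
    ∫ θ, totalUserReward fb B A (capReward R η a) γ n K (θ, c)
        ∂Measure.pi (fun _ => mixedLaw a ε) ≤
      R / (1 - γ) - 3 * η * (1 - ε) ^ N *
        ∫ θ, exploration fb B A θ c.1 c.2 a γ n K ∂Measure.pi (fun _ => highLaw a) := by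
  have := isProbabilityMeasure_lowLaw ha
  have := isProbabilityMeasure_highLaw ha1
  have := isProbabilityMeasure_mixedLaw ha ha1 hε hε1
  set P : (Fin N → ℝ) → ℝ := fun θ => totalUserReward fb B A (capReward R η a) γ n K (θ, c)
  set Z : (Fin N → ℝ) → ℝ := fun θ => exploration fb B A θ c.1 c.2 a γ n K
  have hPm : Measurable P := (measurable_totalUserReward fb B A (measurable_capReward R η a) γ n
    K).comp (measurable_id.prodMk measurable_const)
  have hZm : Measurable Z := (measurable_exploration fb B A a γ n K).comp
    (measurable_id.prodMk measurable_const)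
  have hP : ∀ θ, P θ ∈ Set.Icc 0 (R / (1 - γ) + η * (a / (1 - γ))) := fun θ =>
    totalUserReward_mem fb B A hR hη ha.le hγ hγ1 n K (θ, c)
  have hZ : ∀ θ, Z θ ∈ Set.Icc 0 (a / (1 - γ)) := fun θ =>
    exploration_mem fb B A ha.le hγ hγ1 n K (θ, c)
  have hPu : ∀ θ, Measurable fun x => P (Function.update θ n x) := fun θ =>
    hPm.comp (measurable_update θ)
  have hZu : ∀ θ, Measurable fun x => Z (Function.update θ n x) := fun θ =>
    hZm.comp (measurable_update θ)
  have hZi : ∀ θ, Integrable (fun x => Z (Function.update θ n x)) (highLaw a) := fun θ =>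
    integrable_of_mem_Icc (hZu θ) fun x => hZ _
  have hPhigh : ∀ θ, ∫ x, P (Function.update θ n x) ∂highLaw a ≤
      R / (1 - γ) + η * ∫ x, Z (Function.update θ n x) ∂highLaw a := by
    intro θ
    have h : ∫ x, (R / (1 - γ) + η * Z (Function.update θ n x)) ∂highLaw a =
        R / (1 - γ) + η * ∫ x, Z (Function.update θ n x) ∂highLaw a := by
      rw [integral_add (integrable_const _) ((hZi θ).const_mul η), integral_const_mul]
      simp
    rw [← h]
    exact integral_mono (integrable_of_mem_Icc (hPu θ) fun x => hP _)
      ((integrable_const _).add ((hZi θ).const_mul η)) fun x =>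
        sum_userReward_le hR hη ha.le hγ hγ1 n K
  -- Any x' ≥ a serves as a ghost threshold: the run with x' determines the exploration, and the
  -- true low threshold is crossed along that run.
  have hghost : ∀ θ x', a ≤ x' → ∫ x, P (Function.update θ n x) ∂lowLaw a ≤
      R / (1 - γ) + (η - R / 2 * ((1 - γ) / a)) * Z (Function.update θ n x') := by
    intro θ x' hx'
    set θ' := Function.update θ n x' with hθ'
    have hW := integrable_crossingDiscount (fb := fb) (B := B) (A := A) (θ := θ') (coin := c.1)
      (ω := c.2) (γ := γ) ha n K
    have hWi := integral_crossingDiscount_ge (fb := fb) (B := B) (A := A) (θ := θ')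
      (coin := c.1) (ω := c.2) ha hγ hγ1 n K
    calc ∫ x, P (Function.update θ n x) ∂lowLaw a
        ≤ ∫ x, (R / (1 - γ) + η * Z θ' -
            R / 2 * crossingDiscount fb B A θ' c.1 c.2 a γ n K x) ∂lowLaw a := by
          refine integral_mono_ae (integrable_of_mem_Icc (hPu θ) fun x => hP _)
            ((integrable_const _).sub (hW.const_mul _)) ?_
          filter_upwards [ae_lowLaw] with x hx
          have h := sum_userReward_update_le (fb := fb) (B := B) (A := A) (θ := θ')
            (coin := c.1) (ω := c.2) hR hη ha.le hγ hγ1 hRa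
            (n := n) (by rw [hθ', Function.update_self]; exact hx') hx.1.le hx.2 K
          rw [hθ', Function.update_idem] at h
          exact h
      _ = R / (1 - γ) + η * Z θ' -
            R / 2 * ∫ x, crossingDiscount fb B A θ' c.1 c.2 a γ n K x ∂lowLaw a := by
          rw [integral_sub (integrable_const _) (hW.const_mul _), integral_const_mul]
          simp
      _ ≤ R / (1 - γ) + (η - R / 2 * ((1 - γ) / a)) * Z θ' := by
          have := mul_le_mul_of_nonneg_left hWi (by linarith : 0 ≤ R / 2)
          change R / 2 * ((1 - γ) / a * Z θ') ≤ _ at this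
          linarith
  have hPlow : ∀ θ, ∫ x, P (Function.update θ n x) ∂lowLaw a ≤
      R / (1 - γ) + (η - R / 2 * ((1 - γ) / a)) *
        ∫ x, Z (Function.update θ n x) ∂highLaw a := by
    intro θ
    have h : ∫ x, (R / (1 - γ) + (η - R / 2 * ((1 - γ) / a)) * Z (Function.update θ n x))
        ∂highLaw a = R / (1 - γ) + (η - R / 2 * ((1 - γ) / a)) *
          ∫ x, Z (Function.update θ n x) ∂highLaw a := by
      rw [integral_add (integrable_const _) ((hZi θ).const_mul _), integral_const_mul]
      simp
    rw [← h]
    -- The reward under a low threshold does not involve the ghost, so the bound may be averaged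
    -- over ghosts drawn from `highLaw a`.
    have h2 : ∫ x, P (Function.update θ n x) ∂lowLaw a =
        ∫ _, (∫ x, P (Function.update θ n x) ∂lowLaw a) ∂highLaw a := by simp
    rw [h2]
    refine integral_mono_ae (integrable_const _)
      ((integrable_const _).add ((hZi θ).const_mul _)) ?_
    filter_upwards [ae_highLaw] with x' hx' using hghost θ x' hx'
  -- The gain ηZ enters with total weight 1, and the crossing loss, of weight ε, is at least 4ηZ by
  -- `hεR`; the balance is -3ηZ.
  have hmix : ∀ θ, ∫ x, P (Function.update θ n x) ∂mixedLaw a ε ≤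
      R / (1 - γ) - 3 * η * ∫ x, Z (Function.update θ n x) ∂highLaw a := by
    intro θ
    rw [integral_mixedLaw ha ha1 hε hε1 (hPu θ) fun x => hP _]
    have h1 := mul_le_mul_of_nonneg_left (hPhigh θ) (by linarith : 0 ≤ 1 - ε)
    have h2 := mul_le_mul_of_nonneg_left (hPlow θ) hε
    have h3 : 0 ≤ ∫ x, Z (Function.update θ n x) ∂highLaw a :=
      integral_nonneg fun x => (hZ _).1
    have h4 := mul_le_mul_of_nonneg_right hεR h3
    linarith
  have hIm : Measurable fun θ => ∫ x, Z (Function.update θ n x) ∂highLaw a :=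
    ((hZm.comp measurable_update').stronglyMeasurable.integral_prod_right'
      (ν := highLaw a)).measurable
  have hIP : Measurable fun θ => ∫ x, P (Function.update θ n x) ∂mixedLaw a ε :=
    ((hPm.comp measurable_update').stronglyMeasurable.integral_prod_right'
      (ν := mixedLaw a ε)).measurable
  have hmean : ∀ (lam : Measure ℝ) [IsProbabilityMeasure lam] (g : ℝ → ℝ) (C : ℝ),
      Measurable g → (∀ x, g x ∈ Set.Icc 0 C) → ∫ x, g x ∂lam ∈ Set.Icc 0 C := by
    intro lam _ g C hg hC
    refine ⟨integral_nonneg fun x => (hC x).1, ?_⟩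
    calc ∫ x, g x ∂lam ≤ ∫ _, C ∂lam :=
          integral_mono (integrable_of_mem_Icc hg hC) (integrable_const _) fun x => (hC x).2
      _ = C := by simp
  have hI : ∀ θ, ∫ x, Z (Function.update θ n x) ∂highLaw a ∈ Set.Icc 0 (a / (1 - γ)) :=
    fun θ => hmean _ _ _ (hZu θ) fun x => hZ _
  -- The other thresholds still follow the mixture. Since the exploration is non-negative, all of
  -- them may be replaced by high ones at the price (1-ε)^N.
  have hdom := integral_pi_highLaw_le (N := N) ha ha1 hε hε1 hIm hI
  rw [← integral_update (highLaw a) n hZm hZ] at hdom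
  calc ∫ θ, P θ ∂Measure.pi (fun _ => mixedLaw a ε)
      = ∫ θ, ∫ x, P (Function.update θ n x) ∂mixedLaw a ε
          ∂Measure.pi (fun _ => mixedLaw a ε) := integral_update _ n hPm hP
    _ ≤ ∫ θ, (R / (1 - γ) - 3 * η * ∫ x, Z (Function.update θ n x) ∂highLaw a)
          ∂Measure.pi (fun _ => mixedLaw a ε) :=
        integral_mono (integrable_of_mem_Icc hIP fun θ => hmean _ _ _ (hPu θ) fun x => hP _)
          ((integrable_const _).sub ((integrable_of_mem_Icc hIm hI).const_mul _)) hmix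
    _ = R / (1 - γ) - 3 * η * ∫ θ, ∫ x, Z (Function.update θ n x) ∂highLaw a
          ∂Measure.pi (fun _ => mixedLaw a ε) := by
        rw [integral_sub (integrable_const _) ((integrable_of_mem_Icc hIm hI).const_mul _),
          integral_const_mul]
        simp
    _ ≤ R / (1 - γ) - 3 * η * (1 - ε) ^ N * ∫ θ, Z θ ∂Measure.pi (fun _ => highLaw a) := by
        have := mul_le_mul_of_nonneg_left hdom (by linarith : 0 ≤ 3 * η)
        linarith

theorem integrable_totalUserReward (μ : Measure ℝ) [IsProbabilityMeasure μ] (hR : 0 ≤ R)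
    (hη : 0 ≤ η) (ha : 0 ≤ a) (hγ : 0 ≤ γ) (hγ1 : γ < 1) (n : Fin N) (K : ℕ) :
    Integrable (totalUserReward fb B A (capReward R η a) γ n K) (interactionLaw A μ) :=
  integrable_of_mem_Icc
    (measurable_totalUserReward fb B A (measurable_capReward R η a) γ n K)
    (totalUserReward_mem fb B A hR hη ha hγ hγ1 n K)

theorem integrable_exploration (μ : Measure ℝ) [IsProbabilityMeasure μ] (ha : 0 ≤ a)
    (hγ : 0 ≤ γ) (hγ1 : γ < 1) (n : Fin N) (K : ℕ) :
    Integrable (fun x => exploration fb B A x.1 x.2.1 x.2.2 a γ n K) (interactionLaw A μ) :=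
  integrable_of_mem_Icc (measurable_exploration fb B A a γ n K)
    (exploration_mem fb B A ha hγ hγ1 n K)

theorem integral_totalUserReward_mixedLaw_le (hR : 0 ≤ R) (hη : 0 ≤ η) (ha : 0 < a)
    (ha1 : a < 1) (hγ : 0 ≤ γ) (hγ1 : γ < 1) (hRa : 2 * (η * a / (1 - γ)) ≤ R) {ε : ℝ}
    (hε : 0 ≤ ε) (hε1 : ε ≤ 1) (hεR : 4 * η ≤ ε * (R / 2 * ((1 - γ) / a))) (n : Fin N)
    (K : ℕ) :
    ∫ x, totalUserReward fb B A (capReward R η a) γ n K x ∂interactionLaw A (mixedLaw a ε) ≤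
      R / (1 - γ) - 3 * η * (1 - ε) ^ N *
        ∫ x, exploration fb B A x.1 x.2.1 x.2.2 a γ n K ∂interactionLaw A (highLaw a) := by
  have := isProbabilityMeasure_highLaw ha1
  have := isProbabilityMeasure_mixedLaw ha ha1 hε hε1
  have i1 := integrable_totalUserReward fb B A (mixedLaw a ε) hR hη ha.le hγ hγ1 n K
  have i2 := integrable_exploration fb B A (highLaw a) ha.le hγ hγ1 n K
  rw [interactionLaw] at i1 i2 ⊢
  rw [interactionLaw, integral_prod_symm _ i1, integral_prod_symm _ i2, ← integral_const_mul]
  have h1 := i2.integral_prod_right.const_mul (3 * η * (1 - ε) ^ N)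
  refine (integral_mono i1.integral_prod_right ((integrable_const (R / (1 - γ))).sub h1)
    (integral_totalUserReward_thresholds_le fb B A hR hη ha ha1 hγ hγ1 hRa hε hε1 hεR n
      K)).trans_eq ?_
  simp only [Pi.sub_apply]
  rw [integral_sub (integrable_const _) h1]
  simp

theorem integral_totalUserReward_le (μ : Measure ℝ) [IsProbabilityMeasure μ] (hR : 0 ≤ R)
    (hη : 0 ≤ η) (ha : 0 ≤ a) (hγ : 0 ≤ γ) (hγ1 : γ < 1) (n : Fin N) (K : ℕ) :
    ∫ x, totalUserReward fb B A (capReward R η a) γ n K x ∂interactionLaw A μ ≤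
      R / (1 - γ) + η * ∫ x, exploration fb B A x.1 x.2.1 x.2.2 a γ n K ∂interactionLaw A μ := by
  have i1 := integrable_totalUserReward fb B A μ hR hη ha hγ hγ1 n K
  have i2 := (integrable_exploration fb B A μ ha hγ hγ1 n K).const_mul η
  refine (integral_mono i1 ((integrable_const (R / (1 - γ))).add i2) fun x =>
    sum_userReward_le hR hη ha hγ hγ1 n K).trans_eq ?_
  simp only [Pi.add_apply]
  rw [integral_add (integrable_const _) i2, integral_const_mul]
  simp

/-- In the flat case exploration must be bounded from above. Its shortfall from the maximum a/(1-γ)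
is non-negative, so the comparison with high thresholds applies to the shortfall. -/
theorem integral_exploration_gap_ge (ha : 0 < a) (ha1 : a < 1) (hγ : 0 ≤ γ) (hγ1 : γ < 1)
    {ε : ℝ} (hε : 0 ≤ ε) (hε1 : ε ≤ 1) (n : Fin N) (K : ℕ) :
    (1 - ε) ^ N * (a / (1 - γ) -
        ∫ x, exploration fb B A x.1 x.2.1 x.2.2 a γ n K ∂interactionLaw A (highLaw a)) ≤
      a / (1 - γ) -
        ∫ x, exploration fb B A x.1 x.2.1 x.2.2 a γ n K ∂interactionLaw A (mixedLaw a ε) := by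
  have := isProbabilityMeasure_highLaw ha1
  have := isProbabilityMeasure_mixedLaw ha ha1 hε hε1
  have hm : Measurable fun x : (Fin N → ℝ) × (ℕ → unitInterval) × A.Seed =>
      a / (1 - γ) - exploration fb B A x.1 x.2.1 x.2.2 a γ n K :=
    measurable_const.sub (measurable_exploration fb B A a γ n K)
  have hb : ∀ x : (Fin N → ℝ) × (ℕ → unitInterval) × A.Seed,
      a / (1 - γ) - exploration fb B A x.1 x.2.1 x.2.2 a γ n K ∈ Set.Icc 0 (a / (1 - γ)) := by
    intro x
    have h := exploration_mem fb B A ha.le hγ hγ1 n K x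
    exact ⟨by linarith [h.2], by linarith [h.1]⟩
  have e : ∀ (μ : Measure ℝ) [IsProbabilityMeasure μ], a / (1 - γ) -
      ∫ x, exploration fb B A x.1 x.2.1 x.2.2 a γ n K ∂interactionLaw A μ =
      ∫ x, (a / (1 - γ) - exploration fb B A x.1 x.2.1 x.2.2 a γ n K) ∂interactionLaw A μ := by
    intro μ _
    rw [integral_sub (integrable_const _) (integrable_exploration fb B A μ ha.le hγ hγ1 n K)]
    simp
  have i1 : Integrable (fun x : (Fin N → ℝ) × (ℕ → unitInterval) × A.Seed =>
      a / (1 - γ) - exploration fb B A x.1 x.2.1 x.2.2 a γ n K)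
      (interactionLaw A (highLaw a)) := integrable_of_mem_Icc hm hb
  have i2 : Integrable (fun x : (Fin N → ℝ) × (ℕ → unitInterval) × A.Seed =>
      a / (1 - γ) - exploration fb B A x.1 x.2.1 x.2.2 a γ n K)
      (interactionLaw A (mixedLaw a ε)) := integrable_of_mem_Icc hm hb
  rw [e, e]
  rw [interactionLaw] at i1 i2 ⊢
  rw [interactionLaw, integral_prod_symm _ i1, integral_prod_symm _ i2, ← integral_const_mul]
  exact integral_mono (i1.integral_prod_right.const_mul _) i2.integral_prod_right fun c =>
    integral_pi_highLaw_le ha ha1 hε hε1 (hm.comp (measurable_id.prodMk measurable_const))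
      fun θ => hb (θ, c)

/-- The expected reward is the limit of the expected rewards over finite horizons. -/
theorem tendsto_integral_totalUserReward (μ : Measure ℝ) [IsProbabilityMeasure μ] (hR : 0 ≤ R)
    (hη : 0 ≤ η) (ha : 0 ≤ a) (hγ : 0 ≤ γ) (hγ1 : γ < 1) :
    Filter.Tendsto (fun K => ∑ n, ∫ x, totalUserReward fb B A (capReward R η a) γ n K x
      ∂interactionLaw A μ) Filter.atTop
      (nhds (expectedReward μ (capReward R η a) γ fb B A)) := by
  have e : ∀ K, ∑ n, ∫ x, totalUserReward fb B A (capReward R η a) γ n K x ∂interactionLaw A μ =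
      ∫ x, ∑ k ∈ Finset.range K, stepReward (capReward R η a) γ fb B A x.1 x.2.1 x.2.2 k
        ∂interactionLaw A μ := by
    intro K
    rw [← integral_finsetSum _ fun n _ =>
      integrable_totalUserReward fb B A μ hR hη ha hγ hγ1 n K]
    congr 1
    ext x
    simp only [totalUserReward, stepReward_eq_sum]
    exact Finset.sum_comm
  have hsum : ∀ K (x : (Fin N → ℝ) × (ℕ → unitInterval) × A.Seed),
      ∑ k ∈ Finset.range K, stepReward (capReward R η a) γ fb B A x.1 x.2.1 x.2.2 k =
        ∑ n, totalUserReward fb B A (capReward R η a) γ n K x := by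
    intro K x
    simp only [totalUserReward, stepReward_eq_sum]
    exact Finset.sum_comm
  have hnn : ∀ (x : (Fin N → ℝ) × (ℕ → unitInterval) × A.Seed) k,
      0 ≤ stepReward (capReward R η a) γ fb B A x.1 x.2.1 x.2.2 k := by
    intro x k
    rw [stepReward_eq_sum]
    exact Finset.sum_nonneg fun n _ => userReward_nonneg (capReward_nonneg hR hη ha) hγ n k
  have hle : ∀ (x : (Fin N → ℝ) × (ℕ → unitInterval) × A.Seed) K,
      ∑ k ∈ Finset.range K, stepReward (capReward R η a) γ fb B A x.1 x.2.1 x.2.2 k ≤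
        ∑ _n : Fin N, (R / (1 - γ) + η * (a / (1 - γ))) := by
    intro x K
    rw [hsum]
    exact Finset.sum_le_sum fun n _ => (totalUserReward_mem fb B A hR hη ha hγ hγ1 n K x).2
  simp only [e]
  refine tendsto_integral_of_dominated_convergence
    (fun _ => ∑ _n : Fin N, (R / (1 - γ) + η * (a / (1 - γ)))) (fun K => ?_)
    (integrable_const _) (fun K => Filter.Eventually.of_forall fun x => ?_)
    (Filter.Eventually.of_forall fun x => ?_)
  · simp only [hsum]
    exact (Finset.measurable_sum _ fun n _ => measurable_totalUserReward fb B A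
      (measurable_capReward R η a) γ n K).aestronglyMeasurable
  · rw [Real.norm_of_nonneg (Finset.sum_nonneg fun k _ => hnn x k)]
    exact hle x K
  · exact (summable_of_sum_range_le (hnn x) (hle x)).hasSum.tendsto_sum_nat

end Expectation

/-! ### The lower bound -/

/-- As ε tends to 0 from above, the failure bound tends to 0, (1-ε)^N to 1 and the last expression
to ρ/(1-γ), so every requirement has slack in the limit. -/
theorem exists_small_mass {γ R ρ a κ : ℝ} (hγ1 : γ < 1) (ha : 0 < a) (hκ : 0 < κ) (N : ℕ) :
    ∃ ε, 0 < ε ∧ ε < a ∧ 2 * ε * (ρ / (1 - γ)) / R ≤ 1 / 2 ∧ 1 / 2 ≤ (1 - ε) ^ N ∧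
      ρ / (1 - γ) - κ ≤ (1 - 2 * ε * (ρ / (1 - γ)) / R) * (ρ - 2 * ε * (ρ / (1 - γ))) /
        (1 - (1 - 2 * ε * (ρ / (1 - γ)) / R) * γ) := by
  have h1 : Filter.Tendsto (fun ε : ℝ => 2 * ε * (ρ / (1 - γ)) / R) (nhds 0) (nhds 0) := by
    have : Continuous fun ε : ℝ => 2 * ε * (ρ / (1 - γ)) / R := by fun_prop
    simpa using this.tendsto 0
  have h2 : Filter.Tendsto (fun ε : ℝ => (1 - ε) ^ N) (nhds 0) (nhds 1) := by
    have : Continuous fun ε : ℝ => (1 - ε) ^ N := by fun_prop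
    simpa using this.tendsto 0
  have h3 : Filter.Tendsto (fun ε : ℝ => 2 * ε * (ρ / (1 - γ))) (nhds 0) (nhds 0) := by
    have : Continuous fun ε : ℝ => 2 * ε * (ρ / (1 - γ)) := by fun_prop
    simpa using this.tendsto 0
  have h4 : Filter.Tendsto (fun ε : ℝ => (1 - 2 * ε * (ρ / (1 - γ)) / R) *
      (ρ - 2 * ε * (ρ / (1 - γ))) / (1 - (1 - 2 * ε * (ρ / (1 - γ)) / R) * γ)) (nhds 0)
      (nhds (ρ / (1 - γ))) := by
    have hne : 1 - (1 - 0) * γ ≠ 0 := by linarith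
    have := ((h1.const_sub 1).mul (h3.const_sub ρ)).div
      (((h1.const_sub 1).mul_const γ).const_sub 1) hne
    simp only [sub_zero, one_mul] at this
    exact this
  have hev : ∀ᶠ ε : ℝ in nhdsWithin 0 (Set.Ioi 0), 0 < ε ∧ ε < a ∧
      2 * ε * (ρ / (1 - γ)) / R ≤ 1 / 2 ∧ 1 / 2 ≤ (1 - ε) ^ N ∧
      ρ / (1 - γ) - κ ≤ (1 - 2 * ε * (ρ / (1 - γ)) / R) * (ρ - 2 * ε * (ρ / (1 - γ))) /
        (1 - (1 - 2 * ε * (ρ / (1 - γ)) / R) * γ) := by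
    filter_upwards [self_mem_nhdsWithin, nhdsWithin_le_nhds (Iio_mem_nhds ha),
      nhdsWithin_le_nhds (h1.eventually_le_const (by norm_num : (0 : ℝ) < 1 / 2)),
      nhdsWithin_le_nhds (h2.eventually_const_le (by norm_num : (1 / 2 : ℝ) < 1)),
      nhdsWithin_le_nhds (h4.eventually_const_le (by linarith : ρ / (1 - γ) - κ < ρ / (1 - γ)))]
      with ε e1 e2 e3 e4 e5 using ⟨e1, e2, e3, e4, e5⟩
  exact hev.exists

/-- At least half of the exploration missed under `highLaw a` is also missed here, and each missed
unit costs η. -/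
theorem expectedReward_le_of_flat {N : ℕ} {fb : FeedbackModel} {B : ℝ} (A : LearningAlgorithm N)
    {R η a γ : ℝ} (hR : 0 ≤ R) (hη : 0 ≤ η) (ha : 0 < a) (ha1 : a < 1) (hγ : 0 ≤ γ)
    (hγ1 : γ < 1) {ε : ℝ} (hε : 0 ≤ ε) (hε1 : ε ≤ 1) (hN : 1 / 2 ≤ (1 - ε) ^ N) (K : ℕ) :
    ∑ n, ∫ x, totalUserReward fb B A (capReward R η a) γ n K x
        ∂interactionLaw A (mixedLaw a ε) ≤
      N * (R / (1 - γ) + η * (a / (1 - γ)) / 2) + η / 2 *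
        ∑ n, ∫ x, exploration fb B A x.1 x.2.1 x.2.2 a γ n K ∂interactionLaw A (highLaw a) := by
  have := isProbabilityMeasure_highLaw ha1
  have := isProbabilityMeasure_mixedLaw ha ha1 hε hε1
  have h : ∀ n ∈ (Finset.univ : Finset (Fin N)),
      ∫ x, totalUserReward fb B A (capReward R η a) γ n K x ∂interactionLaw A (mixedLaw a ε) ≤
        (R / (1 - γ) + η * (a / (1 - γ)) / 2) + η / 2 *
          ∫ x, exploration fb B A x.1 x.2.1 x.2.2 a γ n K ∂interactionLaw A (highLaw a) := by
    intro n _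
    have h1 := integral_totalUserReward_le fb B A (mixedLaw a ε) hR hη ha.le hγ hγ1 n K
    have h2 := integral_exploration_gap_ge fb B A ha ha1 hγ hγ1 hε hε1 n K
    have h3 : ∫ x, exploration fb B A x.1 x.2.1 x.2.2 a γ n K ∂interactionLaw A (highLaw a) ≤
        a / (1 - γ) := by
      have := integral_mono (integrable_exploration fb B A (highLaw a) ha.le hγ hγ1 n K)
        (integrable_const (a / (1 - γ))) fun x => (exploration_mem fb B A ha.le hγ hγ1 n K x).2
      simpa using this
    have h4 := mul_le_mul_of_nonneg_right hN (sub_nonneg.2 h3)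
    have h5 := mul_le_mul_of_nonneg_left (h4.trans h2) hη
    linarith
  refine (Finset.sum_le_sum h).trans_eq ?_
  rw [Finset.sum_add_distrib, ← Finset.mul_sum, Finset.sum_const, Finset.card_univ,
    Fintype.card_fin, nsmul_eq_mul]

theorem expectedReward_le_of_steep {N : ℕ} {fb : FeedbackModel} {B : ℝ} (A : LearningAlgorithm N)
    {R η a γ : ℝ} (hR : 0 ≤ R) (hη : 0 ≤ η) (ha : 0 < a) (ha1 : a < 1) (hγ : 0 ≤ γ)
    (hγ1 : γ < 1) (hRa : 2 * (η * a / (1 - γ)) ≤ R) {ε : ℝ} (hε : 0 ≤ ε) (hε1 : ε ≤ 1)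
    (hN : 1 / 2 ≤ (1 - ε) ^ N) (hεR : 4 * η ≤ ε * (R / 2 * ((1 - γ) / a))) (K : ℕ) :
    ∑ n, ∫ x, totalUserReward fb B A (capReward R η a) γ n K x
        ∂interactionLaw A (mixedLaw a ε) ≤
      N * (R / (1 - γ)) - 3 / 2 * η *
        ∑ n, ∫ x, exploration fb B A x.1 x.2.1 x.2.2 a γ n K ∂interactionLaw A (highLaw a) := by
  have h : ∀ n ∈ (Finset.univ : Finset (Fin N)),
      ∫ x, totalUserReward fb B A (capReward R η a) γ n K x ∂interactionLaw A (mixedLaw a ε) ≤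
        R / (1 - γ) - 3 / 2 * η *
          ∫ x, exploration fb B A x.1 x.2.1 x.2.2 a γ n K ∂interactionLaw A (highLaw a) := by
    intro n _
    have h1 := integral_totalUserReward_mixedLaw_le fb B A hR hη ha ha1 hγ hγ1 hRa hε hε1 hεR n K
    have h3 : 0 ≤ ∫ x, exploration fb B A x.1 x.2.1 x.2.2 a γ n K
        ∂interactionLaw A (highLaw a) :=
      integral_nonneg fun x => (exploration_mem fb B A ha.le hγ hγ1 n K x).1
    have h4 := mul_le_mul_of_nonneg_right hN (mul_nonneg (by linarith : 0 ≤ 3 * η) h3)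
    linarith
  refine (Finset.sum_le_sum h).trans_eq ?_
  rw [Finset.sum_sub_distrib, ← Finset.mul_sum]
  simp

theorem exists_environment_deltaRegret_ge {η L_r L_h γ B δ : ℝ} (hη : 0 < η) (hr : η ≤ L_r)
    (hh : 1 + η ≤ L_h) (hγ : 0 ≤ γ) (hγ1 : γ < 1) (fb : FeedbackModel) (hB : 0 < B)
    (hδ : 0 ≤ δ) (hδ1 : δ < 1) {N : ℕ} (hN : 0 < N)
    {ystar : Measure ℝ → (ℝ → ℝ) → ℝ → ℝ → ℝ → ℝ}
    (hy : ∀ e ∈ environments L_h L_r, IsOptimalAction (cdf e.1) e.2 γ fb (ystar e.1 e.2))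
    (A : (ℝ → ℝ) → LearningAlgorithm N) :
    ∃ e ∈ environments L_h L_r, N * (η * (η / (1 + η)) / (1 - γ)) / 16 ≤
      deltaRegret e.1 e.2 γ fb B δ (ystar e.1 e.2) (A e.2) := by
  have h1γ : 0 < 1 - γ := by linarith
  have hNr : (0 : ℝ) < N := by exact_mod_cast hN
  -- With this choice 1/(1-a) = 1 + η, so the density on [a, 1) respects `L_h`.
  set a := η / (1 + η) with ha_def
  have ha : 0 < a := by positivity
  have ha1 : a < 1 := by rw [ha_def, div_lt_one (by linarith)]; linarith
  have h1a : 1 / (1 - a) ≤ L_h := by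
    have : 1 / (1 - a) = 1 + η := by
      rw [ha_def]
      field_simp
      ring
    rw [this]
    exact hh
  set c := η * a / (1 - γ) with hc
  have hc0 : 0 < c := by positivity
  have hc' : η * (a / (1 - γ)) = c := by rw [hc]; ring
  -- The three summands ensure in turn N ε₂ ≤ 1/2, ε₂ ≤ a and 2c ≤ R. The reward level grows with
  -- `N`, which the class permits.
  set R := 16 * N * c + 8 * c / a + 2 * c with hRdef
  have hR : 0 < R := by positivity
  have hRa : 2 * c ≤ R := by
    have : 0 ≤ 16 * N * c + 8 * c / a := by positivity
    linarith
  have hmem : ∀ ε, 0 < ε → ε ≤ a → (mixedLaw a ε, capReward R η a) ∈ environments L_h L_r := by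
    intro ε h0 h1
    refine ⟨isThresholdLaw_mixedLaw ha ha1 h0 (h1.trans_lt ha1) ?_ h1a,
      isRewardFunction_capReward hR hη.le ha.le hr⟩
    have : ε / a ≤ 1 := (div_le_one ha).2 h1
    linarith
  -- The value for which the requirement 4η ≤ ε (R/2) (1-γ)/a holds with equality.
  set ε₂ := 8 * c / R with hε₂
  have hε₂0 : 0 < ε₂ := by positivity
  have hε₂a : ε₂ ≤ a := by
    rw [hε₂, div_le_iff₀ hR]
    have : a * (8 * c / a) = 8 * c := by field_simp
    have : 0 ≤ a * (16 * N * c + 2 * c) := by positivity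
    rw [hRdef]
    linarith
  have hε₂1 : ε₂ ≤ 1 := hε₂a.trans ha1.le
  have hε₂R : ε₂ * R = 8 * c := by rw [hε₂]; field_simp
  have hε₂N : 1 / 2 ≤ (1 - ε₂) ^ N := by
    have h := one_add_mul_le_pow (a := -ε₂) (by linarith) N
    have h2 : N * ε₂ ≤ 1 / 2 := by
      rw [hε₂, mul_div_assoc', div_le_iff₀ hR]
      have : 0 ≤ 8 * c / a + 2 * c := by positivity
      rw [hRdef]
      linarith
    rw [← sub_eq_add_neg] at h
    linarith
  have hstep : 4 * η ≤ ε₂ * (R / 2 * ((1 - γ) / a)) := by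
    have e : ε₂ * (R / 2 * ((1 - γ) / a)) = ε₂ * R / 2 * ((1 - γ) / a) := by ring
    rw [e, hε₂R, hc]
    refine le_of_eq ?_
    field_simp
    ring
  obtain ⟨ε₁, h0, h1, h2, h3, h4⟩ := exists_small_mass (R := R) (ρ := R + η * a) (γ := γ) hγ1 ha
    (by positivity : 0 < c / 8) N
  have hε₁1 : ε₁ ≤ 1 := h1.le.trans ha1.le
  have hV₁ := policyValue_ge_of_flat (fb := fb) (a := a) (δ := δ)
    (strictMonoOn_cdf (hmem ε₁ h0 h1.le).1) (cdf_mixedLaw_zero ha ha1 h0.le hε₁1)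
    (cdf_mixedLaw_one ha ha1 h0.le hε₁1) hγ hγ1 hR hη.le ha ha1 h0.le
    (cdf_mixedLaw_break ha ha1 h0.le hε₁1).le hRa h2 hδ hδ1 hB (hy _ (hmem ε₁ h0 h1.le))
  have hV₂ := policyValue_ge_of_steep (fb := fb) (a := a) (δ := δ)
    (strictMonoOn_cdf (hmem ε₂ hε₂0 hε₂a).1) (cdf_mixedLaw_zero ha ha1 hε₂0.le hε₂1)
    (cdf_mixedLaw_one ha ha1 hε₂0.le hε₂1) hγ hγ1 hR.le hη.le ha
    (fun x y => cdf_mixedLaw_sub_ge ha ha1 hε₂0.le hε₂1) (by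
      have e : R * (ε₂ / a) = 8 * (η / (1 - γ)) := by
        rw [mul_div_assoc', mul_comm R, hε₂R, hc]
        field_simp
      have : 0 < η / (1 - γ) := by positivity
      rw [e]
      linarith) hδ hδ1 hB (hy _ (hmem ε₂ hε₂0 hε₂a))
  have := isProbabilityMeasure_mixedLaw ha ha1 h0.le hε₁1
  have := isProbabilityMeasure_mixedLaw ha ha1 hε₂0.le hε₂1
  set alg := A (capReward R η a)
  have hκ : 0 < N * c / 16 := by positivity
  have hE₁ := (tendsto_integral_totalUserReward fb B alg (mixedLaw a ε₁) hR.le hη.le ha.le hγ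
    hγ1).eventually_const_le (sub_lt_self _ hκ)
  have hE₂ := (tendsto_integral_totalUserReward fb B alg (mixedLaw a ε₂) hR.le hη.le ha.le hγ
    hγ1).eventually_const_le (sub_lt_self _ hκ)
  -- One horizon for both environments, so that the same exploration `z` occurs in both bounds.
  obtain ⟨K, k1, k2⟩ := (hE₁.and hE₂).exists
  have u1 := expectedReward_le_of_flat (fb := fb) (B := B) alg hR.le hη.le ha ha1 hγ hγ1 h0.le
    hε₁1 h3 K
  have u2 := expectedReward_le_of_steep (fb := fb) (B := B) alg hR.le hη.le ha ha1 hγ hγ1 hRa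
    hε₂0.le hε₂1 hε₂N hstep K
  set z := ∑ n, ∫ x, exploration fb B alg x.1 x.2.1 x.2.2 a γ n K
    ∂interactionLaw alg (highLaw a)
  rw [hc'] at u1
  -- Little exploration: the benchmark exceeds N R/(1-γ) by at least 7/8 Nc and the algorithm by at
  -- most 3/4 Nc; the truncation error Nc/16 leaves Nc/16. Much exploration: the algorithm falls
  -- short of N R/(1-γ) by more than 3/4 Nc before the truncation error.
  by_cases hz : η * z ≤ N * c / 2
  · refine ⟨_, hmem ε₁ h0 h1.le, ?_⟩
    have e : (R + η * a) / (1 - γ) = R / (1 - γ) + c := by rw [hc, add_div]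
    rw [e] at h4 hV₁
    have hv := mul_le_mul_of_nonneg_left (h4.trans hV₁) hNr.le
    simp only [deltaRegret]
    change _ ≤ _ - expectedReward (mixedLaw a ε₁) (capReward R η a) γ fb B alg
    linarith
  · refine ⟨_, hmem ε₂ hε₂0 hε₂a, ?_⟩
    have hv := mul_le_mul_of_nonneg_left hV₂ hNr.le
    simp only [deltaRegret]
    change _ ≤ _ - expectedReward (mixedLaw a ε₂) (capReward R η a) γ fb B alg
    linarith

end

end SequentialChoice

/-- The learner `A` knows the reward function `r` (it is a function of `r`), the patience `B`, the
number `N` of users and all other parameters, but not the threshold law `μ`. -/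
theorem theorem5 (η : ℝ) (hη : 0 < η) :
    ∃ M : ℝ, 0 < M ∧
      ∀ L_r L_h : ℝ, η ≤ L_r → 1 + η ≤ L_h →
      ∀ (γ : ℝ), 0 ≤ γ → γ < 1 →
      ∀ (fb : SequentialChoice.FeedbackModel) (B : ℝ), 0 < B →
      ∀ (δ : ℝ), 0 ≤ δ → δ < 1 →
      ∀ (N : ℕ), max (L_r + L_h) (0.08 * (L_r + L_h) ^ (2 / 3 : ℝ)) ≤ (N : ℝ) →
      ∀ (ystar : MeasureTheory.Measure ℝ → (ℝ → ℝ) → ℝ → ℝ → ℝ → ℝ),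
        (∀ e ∈ SequentialChoice.environments L_h L_r,
          SequentialChoice.IsOptimalAction (ProbabilityTheory.cdf e.1) e.2 γ fb
            (ystar e.1 e.2)) →
      ∀ (A : (ℝ → ℝ) → SequentialChoice.LearningAlgorithm N),
        ((M * (L_r + L_h) ^ (1 / 3 : ℝ) * (N : ℝ) ^ (2 / 3 : ℝ) : ℝ) : EReal) ≤
          ⨆ e ∈ SequentialChoice.environments L_h L_r,
            ((SequentialChoice.deltaRegret e.1 e.2 γ fb B δ (ystar e.1 e.2) (A e.2) : ℝ) :
              EReal) := by
  have hM : 0 < η * (η / (1 + η)) := by positivity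
  refine ⟨η * (η / (1 + η)) / 16, by positivity, ?_⟩
  intro L_r L_h hr hh γ hγ hγ1 fb B hB δ hδ hδ1 N hN ystar hy A
  have hL : L_r + L_h ≤ N := (le_max_left _ _).trans hN
  have hNr : (0 : ℝ) < N := by linarith
  obtain ⟨e, he, hreg⟩ := SequentialChoice.exists_environment_deltaRegret_ge hη hr hh hγ hγ1 fb hB
    hδ hδ1 (by exact_mod_cast hNr : 0 < N) hy A
  refine le_iSup₂_of_le e he (EReal.coe_le_coe_iff.2 (le_trans ?_ hreg))
  -- The regret already obtained is linear in `N`; L ≤ N weakens it to the claimed rate.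
  have h1 : (L_r + L_h) ^ (1 / 3 : ℝ) * (N : ℝ) ^ (2 / 3 : ℝ) ≤ N := by
    calc (L_r + L_h) ^ (1 / 3 : ℝ) * (N : ℝ) ^ (2 / 3 : ℝ)
        ≤ (N : ℝ) ^ (1 / 3 : ℝ) * (N : ℝ) ^ (2 / 3 : ℝ) := by
          gcongr
          linarith
      _ = N := by
          rw [← Real.rpow_add hNr]
          norm_num
  have h2 : η * (η / (1 + η)) ≤ η * (η / (1 + η)) / (1 - γ) :=
    le_div_self hM.le (by linarith) (by linarith)
  calc η * (η / (1 + η)) / 16 * (L_r + L_h) ^ (1 / 3 : ℝ) * (N : ℝ) ^ (2 / 3 : ℝ)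
      = η * (η / (1 + η)) / 16 * ((L_r + L_h) ^ (1 / 3 : ℝ) * (N : ℝ) ^ (2 / 3 : ℝ)) := by ring
    _ ≤ η * (η / (1 + η)) / 16 * N := by gcongr
    _ ≤ η * (η / (1 + η)) / (1 - γ) / 16 * N := by gcongr
    _ = N * (η * (η / (1 + η)) / (1 - γ)) / 16 := by ring
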